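/- Let $p$ be a prime, $X=\{0,1,\dots,p-1\}$, and let $\pi=(0\ 1\ \cdots\ p-1)$ be the standard cycle on $X$. Let $\mathcal A(p)$ be the group of $p$-adic automorphisms, i.e. of those automorphisms of the rooted tree $X^*$ of finite words whose activity at every vertex is a power of $\pi$. Write $\mathcal A(p)_n$ for the stabilizer of level $n$ in $\mathcal A(p)$, and equip $\mathcal A(p)$ with the metric $$d(g,h)=\inf\Big\{\tfrac{1}{[\mathcal A(p):\mathcal A(p)_n]} \ \Big|\ g^{-1}h\in\mathcal A(p)_n\Big\}.$$ Let $f=x^m+a_{m-1}x^{m-1}+\dots+a_0$ be a monic polynomial over $\mathbb Z/p\mathbb Z$ with $a_0\neq 0$. Let $B=(\mathbb Z/p\mathbb Z)^m$, let $\rho:B\to B$ be the linear map whose matrix is the companion matrix of $f$ (ones below the diagonal, last column $-a_0,\dots,-a_{m-1}$), and let $\omega:B\to\mathbb Z/p\mathbb Z$ be the functional reading the last coordinate. Let $a=\pi(1,\dots,1)\in\mathcal A(p)$ be the automorphism that applies $\pi$ to the first letter of every word, and let $b\in B$ act on $X^*$ by the recursion $b=(a^{\omega(b)},1,\dots,1,\rho(b))$.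 Let $G_{p,f}\le\mathcal A(p)$ be the group generated by $a$ and by the actions of all $b\in B$, and let $\overline{G_{p,f}}$ be its closure in $\mathcal A(p)$. (1) If $m=\deg f\ge 2$, then $\overline{G_{p,f}}$ is a topologically finitely generated closed subgroup of $\mathcal A(p)$, and its Hausdorff dimension with respect to $d$ is $$\dim_H\overline{G_{p,f}}=\begin{cases}1-\dfrac1{p^m}, & p\ne 2,\\[2mm] 1-\dfrac{3}{2^{m+1}}, & p=2.\end{cases}$$ In both cases this equals $1-\dfrac{t}{p^{m+1}}$, where $t=p$ for $p\neq2$ and $t=3$ for $p=2$. (2) Consequently, if for every $m\ge 2$ a monic polynomial $f_m$ over $\mathbb Z/p\mathbb Z$ of degree $m$ with nonzero constant term is chosen, then $\dim_H\overline{G_{p,f_m}}\to 1$ as $m\to\infty$. (3) In particular, for every $\varepsilon>0$ there is a monic polynomial $f$ over $\mathbb Z/p\mathbb Z$ of degree at least $2$ with nonzero constant term such that the topologically finitely generated closed subgroup $\overline{G_{p,f}}$ satisfies $1-\varepsilon<\dim_H\overline{G_{p,f}}<1$. -/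

import Mathlib

open Polynomial

namespace PAdicTree

/-- The automorphism group of the rooted tree of finite words over `X`: the bijections of the set
of words that preserve and reflect the prefix order. -/
def treeAut (X : Type*) : Subgroup (Equiv.Perm (List X)) where
  carrier := {g | ∀ u v, g u <+: g v ↔ u <+: v}
  one_mem' := fun _ _ => Iff.rfl
  mul_mem' := fun {g h} hg hh u v => (hg (h u) (h v)).trans (hh u v)
  inv_mem' := fun {g} hg u v => by
    have := hg (g⁻¹ u) (g⁻¹ v)
    simpa using this.symm

/-- The activity of `g` at every vertex `u` is a power of the standard cycle `x ↦ x + 1` of the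
alphabet `ZMod p = {0, …, p - 1}`. -/
def CyclicActivity {p : ℕ} (g : Equiv.Perm (List (ZMod p))) : Prop :=
  ∀ u, ∃ k : ZMod p, ∀ x, g (u ++ [x]) = g u ++ [x + k]

theorem CyclicActivity.inv {p : ℕ} {g : Equiv.Perm (List (ZMod p))} (hg : CyclicActivity g) :
    CyclicActivity g⁻¹ := by
  intro u
  obtain ⟨k, hk⟩ := hg (g⁻¹ u)
  refine ⟨-k, fun x => ?_⟩
  rw [Equiv.Perm.inv_eq_iff_eq, hk]
  simp

/-- The group of `p`-adic automorphisms of the `p`-ary rooted tree, as a subgroup. -/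
def padicAutSubgroup (p : ℕ) : Subgroup (Equiv.Perm (List (ZMod p))) where
  carrier := {g | g ∈ treeAut (ZMod p) ∧ CyclicActivity g}
  one_mem' := ⟨one_mem _, fun _ => ⟨0, by simp⟩⟩
  mul_mem' := by
    rintro g h ⟨hg, hg'⟩ ⟨hh, hh'⟩
    refine ⟨mul_mem hg hh, fun u => ?_⟩
    obtain ⟨k, hk⟩ := hh' u
    obtain ⟨l, hl⟩ := hg' (h u)
    exact ⟨k + l, fun x => by simp [hk, hl, add_assoc]⟩
  inv_mem' := by
    rintro g ⟨hg, hg'⟩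
    exact ⟨inv_mem hg, hg'.inv⟩

/-- The group `A(p)` of `p`-adic automorphisms of the `p`-ary rooted tree. -/
def PAdicAut (p : ℕ) : Type := padicAutSubgroup p

instance (p : ℕ) : Group (PAdicAut p) := inferInstanceAs (Group (padicAutSubgroup p))

/-- `A(p)` acts on the set of words. -/
def PAdicAut.act {p : ℕ} (g : PAdicAut p) (u : List (ZMod p)) : List (ZMod p) := g.1 u

@[simp] theorem act_one {p : ℕ} (u : List (ZMod p)) : (1 : PAdicAut p).act u = u := rfl

@[simp] theorem act_mul {p : ℕ} (g h : PAdicAut p) (u : List (ZMod p)) :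
    (g * h).act u = g.act (h.act u) := rfl

theorem act_ext {p : ℕ} {g h : PAdicAut p} (H : ∀ u, g.act u = h.act u) : g = h :=
  Subtype.ext (Equiv.ext H)

theorem act_nil {p : ℕ} (g : PAdicAut p) : g.act [] = [] := by
  have h := (g.2.1 [] (g.1⁻¹ [])).2 List.nil_prefix
  simpa [PAdicAut.act] using h

theorem exists_act_append {p : ℕ} (g : PAdicAut p) (u : List (ZMod p)) :
    ∃ k : ZMod p, ∀ x, g.act (u ++ [x]) = g.act u ++ [x + k] := g.2.2 u

theorem length_act {p : ℕ} (g : PAdicAut p) (u : List (ZMod p)) :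
    (g.act u).length = u.length := by
  induction u using List.reverseRecOn with
  | nil => simp [act_nil]
  | append_singleton u x ih =>
    obtain ⟨k, hk⟩ := exists_act_append g u
    simp [hk, ih]

theorem mem_padicAutSubgroup {p : ℕ} {g : Equiv.Perm (List (ZMod p))} (h0 : g [] = [])
    (hg : CyclicActivity g) : g ∈ padicAutSubgroup p := by
  have key : ∀ f : Equiv.Perm (List (ZMod p)), CyclicActivity f →
      ∀ u v, u <+: v → f u <+: f v := by
    rintro f hf u _ ⟨w, rfl⟩
    induction w using List.reverseRecOn with
    | nil => simp
    | append_singleton w x ih =>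
      obtain ⟨k, hk⟩ := hf (u ++ w)
      rw [← List.append_assoc, hk]
      exact ih.trans (List.prefix_append _ _)
  refine ⟨fun u v => ⟨fun h => ?_, key g hg u v⟩, hg⟩
  simpa using key g⁻¹ hg.inv _ _ h

/-- The stabilizer `A(p)_n` of level `n` of the tree. -/
def levelStab (p n : ℕ) : Subgroup (PAdicAut p) where
  carrier := {g | ∀ u, u.length = n → g.act u = u}
  one_mem' := fun _ _ => rfl
  mul_mem' := fun {g h} hg hh u hu => by rw [act_mul, hh u hu, hg u hu]
  inv_mem' := fun {g} hg u hu => by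
    conv_lhs => rw [← hg u hu, ← act_mul, inv_mul_cancel, act_one]

theorem mem_levelStab {p n : ℕ} {g : PAdicAut p} :
    g ∈ levelStab p n ↔ ∀ u, u.length = n → g.act u = u := Iff.rfl

/-- The map on words that adds `k` to the first letter, that is, the action of `a ^ k`. -/
def shiftWord {p : ℕ} (k : ZMod p) : List (ZMod p) → List (ZMod p)
  | [] => []
  | x :: w => (x + k) :: w

theorem shiftWord_shiftWord {p : ℕ} (k l : ZMod p) (u : List (ZMod p)) :
    shiftWord k (shiftWord l u) = shiftWord (l + k) u := by
  cases u <;> simp [shiftWord, add_assoc]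

theorem shiftWord_zero {p : ℕ} (u : List (ZMod p)) : shiftWord 0 u = u := by
  cases u <;> simp [shiftWord]

theorem shiftWord_append {p : ℕ} (k : ZMod p) (u : List (ZMod p)) :
    ∃ l : ZMod p, ∀ x, shiftWord k (u ++ [x]) = shiftWord k u ++ [x + l] := by
  cases u with
  | nil => exact ⟨k, fun x => rfl⟩
  | cons y w => exact ⟨0, fun x => by simp [shiftWord]⟩

/-- The automorphism `a ^ k`, where `a = π (1, …, 1)` is the rooted automorphism that applies the
standard cycle to the first letter of each word. -/
def rootShift (p : ℕ) (k : ZMod p) : PAdicAut p :=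
  ⟨{ toFun := shiftWord k
     invFun := shiftWord (-k)
     left_inv := fun u => by rw [shiftWord_shiftWord, add_neg_cancel, shiftWord_zero]
     right_inv := fun u => by rw [shiftWord_shiftWord, neg_add_cancel, shiftWord_zero] },
   mem_padicAutSubgroup rfl (shiftWord_append k)⟩

section Spinal

variable {p : ℕ} {B : Type*} [AddCommGroup B] [Module (ZMod p) B]

/-- The action of `b : B` on words, given by the recursion `b = (ω(b), 1, …, 1, ρ(b))`: on the
subtree of the letter `0` it acts as `a ^ ω(b)`, on the subtree of the letter `p - 1` as `ρ(b)`,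
and it is trivial on the other subtrees of level one. -/
def spinalWord (ω : B →ₗ[ZMod p] ZMod p) (ρ : B →ₗ[ZMod p] B) :
    B → List (ZMod p) → List (ZMod p)
  | _, [] => []
  | b, x :: w =>
    if x = 0 then x :: shiftWord (ω b) w
    else if x = -1 then x :: spinalWord ω ρ (ρ b) w
    else x :: w

theorem spinalWord_spinalWord (ω : B →ₗ[ZMod p] ZMod p) (ρ : B →ₗ[ZMod p] B) (b c : B)
    (u : List (ZMod p)) :
    spinalWord ω ρ b (spinalWord ω ρ c u) = spinalWord ω ρ (c + b) u := by
  induction u generalizing b c with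
  | nil => simp [spinalWord]
  | cons x w ih =>
    by_cases h0 : x = 0
    · simp [spinalWord, h0, shiftWord_shiftWord]
    · by_cases h1 : x = -1
      · simp only [spinalWord, if_neg h0, if_pos h1, ih, map_add]
      · simp [spinalWord, h0, h1]

theorem spinalWord_zero (ω : B →ₗ[ZMod p] ZMod p) (ρ : B →ₗ[ZMod p] B) (u : List (ZMod p)) :
    spinalWord ω ρ 0 u = u := by
  induction u with
  | nil => simp [spinalWord]
  | cons x w ih => simp [spinalWord, ih, shiftWord_zero]

theorem spinalWord_append (ω : B →ₗ[ZMod p] ZMod p) (ρ : B →ₗ[ZMod p] B) (b : B)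
    (u : List (ZMod p)) :
    ∃ l : ZMod p, ∀ x, spinalWord ω ρ b (u ++ [x]) = spinalWord ω ρ b u ++ [x + l] := by
  induction u generalizing b with
  | nil => exact ⟨0, fun x => by simp [spinalWord, shiftWord]⟩
  | cons y w ih =>
    by_cases h0 : y = 0
    · obtain ⟨l, hl⟩ := shiftWord_append (ω b) w
      exact ⟨l, fun x => by simp [spinalWord, h0, hl]⟩
    · by_cases h1 : y = -1
      · obtain ⟨l, hl⟩ := ih (ρ b)
        refine ⟨l, fun x => ?_⟩
        simp only [List.cons_append, spinalWord, if_neg h0, if_pos h1, hl]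
      · exact ⟨0, fun x => by simp [spinalWord, h0, h1]⟩

/-- The `p`-adic automorphism by which `b : B` acts on the tree. -/
def spinal (ω : B →ₗ[ZMod p] ZMod p) (ρ : B →ₗ[ZMod p] B) (b : B) : PAdicAut p :=
  ⟨{ toFun := spinalWord ω ρ b
     invFun := spinalWord ω ρ (-b)
     left_inv := fun u => by rw [spinalWord_spinalWord, add_neg_cancel, spinalWord_zero]
     right_inv := fun u => by rw [spinalWord_spinalWord, neg_add_cancel, spinalWord_zero] },
   mem_padicAutSubgroup rfl (spinalWord_append ω ρ b)⟩

/-- The group `G_{ω,ρ}` generated by `A = ⟨a⟩` and `B` inside `A(p)`. -/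
def spinalGroup (ω : B →ₗ[ZMod p] ZMod p) (ρ : B →ₗ[ZMod p] B) : Subgroup (PAdicAut p) :=
  Subgroup.closure (Set.range (rootShift p) ∪ Set.range (spinal ω ρ))

end Spinal

/-- The companion matrix of `f`, of size `m = deg f`: ones below the diagonal and last column
`-a_0, …, -a_{m-1}`. -/
def companion {p : ℕ} (f : (ZMod p)[X]) :
    Matrix (Fin f.natDegree) (Fin f.natDegree) (ZMod p) :=
  Matrix.of fun i j =>
    if (j : ℕ) + 1 = f.natDegree then -f.coeff i else if (i : ℕ) = j + 1 then 1 else 0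

/-- The row matrix `[0 ⋯ 0 1]` of size `m = deg f`. -/
def lastRow {p : ℕ} (f : (ZMod p)[X]) : Matrix Unit (Fin f.natDegree) (ZMod p) :=
  Matrix.of fun _ j => if (j : ℕ) + 1 = f.natDegree then 1 else 0

/-- The linear map `ρ` of `B = (ZMod p)^m` whose matrix is the companion matrix of `f`. -/
def rho {p : ℕ} (f : (ZMod p)[X]) :
    (Fin f.natDegree → ZMod p) →ₗ[ZMod p] (Fin f.natDegree → ZMod p) :=
  (companion f).mulVecLin

/-- The functional `ω` on `B = (ZMod p)^m` whose matrix is `[0 ⋯ 0 1]`. -/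
def omega {p : ℕ} (f : (ZMod p)[X]) : (Fin f.natDegree → ZMod p) →ₗ[ZMod p] ZMod p :=
  (LinearMap.proj ()).comp (lastRow f).mulVecLin

/-- The group `G_{p,f}` of `p`-adic automorphisms. -/
def polyGroup {p : ℕ} (f : (ZMod p)[X]) : Subgroup (PAdicAut p) :=
  spinalGroup (omega f) (rho f)

section Metric

variable (p : ℕ)

theorem levelStab_zero : levelStab p 0 = ⊤ := by
  refine eq_top_iff.2 fun g _ u hu => ?_
  rw [List.length_eq_zero_iff.1 hu, act_nil]

theorem levelStab_succ_le (n : ℕ) : levelStab p (n + 1) ≤ levelStab p n := by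
  intro g hg u hu
  obtain ⟨k, hk⟩ := exists_act_append g u
  have h := hg (u ++ [0]) (by simp [hu])
  rw [hk] at h
  exact (List.append_inj h (by rw [length_act])).1

theorem levelStab_antitone : Antitone (levelStab p) :=
  antitone_nat_of_succ_le (levelStab_succ_le p)

instance levelStab_normal (n : ℕ) : (levelStab p n).Normal where
  conj_mem := fun h hh g u hu => by
    have h1 : h.act (g⁻¹.act u) = g⁻¹.act u := hh _ (by rw [length_act, hu])
    rw [act_mul, act_mul, h1, ← act_mul, mul_inv_cancel, act_one]

variable [Fact p.Prime]

instance levelStab_finiteIndex (n : ℕ) : (levelStab p n).FiniteIndex := by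
  let e : PAdicAut p → (List.Vector (ZMod p) n → List.Vector (ZMod p) n) :=
    fun g v => ⟨g.act v.1, by rw [length_act, v.2]⟩
  have : Finite (PAdicAut p ⧸ levelStab p n) := by
    refine Finite.of_injective
      (Quotient.lift (s := QuotientGroup.leftRel (levelStab p n)) e ?_) ?_
    · intro g h hgh
      rw [← Quotient.eq_iff_equiv] at hgh
      have hm : g⁻¹ * h ∈ levelStab p n := QuotientGroup.eq.1 hgh
      funext v
      refine Subtype.ext ?_
      have := congrArg g.act (hm v.1 v.2)
      rw [← act_mul, mul_inv_cancel_left] at this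
      exact this.symm
    · intro x y
      refine Quotient.inductionOn₂ x y fun g h hgh => ?_
      refine QuotientGroup.eq.2 fun u hu => ?_
      have : g.act u = h.act u := congrArg Subtype.val (congrFun hgh ⟨u, hu⟩)
      rw [act_mul, ← this, ← act_mul, inv_mul_cancel, act_one]
  exact Subgroup.finiteIndex_of_finite_quotient

theorem levelStab_succ_lt (n : ℕ) : levelStab p (n + 1) < levelStab p n := by
  have key : ∀ n, ∃ g : PAdicAut p, g ∈ levelStab p n ∧ g ∉ levelStab p (n + 1) := by
    rintro (_ | n)
    · refine ⟨rootShift p 1, by simp [levelStab_zero], fun h => ?_⟩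
      have := h [0] rfl
      simp [rootShift, PAdicAut.act, shiftWord] at this
    · let ω : (ℕ → ZMod p) →ₗ[ZMod p] ZMod p := LinearMap.proj 0
      let ρ : (ℕ → ZMod p) →ₗ[ZMod p] (ℕ → ZMod p) := LinearMap.funLeft _ _ Nat.succ
      have h1 : ∀ n (b : ℕ → ZMod p), (∀ i < n, b i = 0) →
          ∀ u : List (ZMod p), u.length = n + 1 → spinalWord ω ρ b u = u := by
        intro n
        induction n with
        | zero =>
          intro b _ u hu
          obtain ⟨x, rfl⟩ := List.length_eq_one_iff.1 hu
          simp [spinalWord, shiftWord]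
        | succ n ih =>
          intro b hb u hu
          obtain ⟨x, w, rfl⟩ := List.exists_cons_of_length_eq_add_one hu
          have hω : ω b = 0 := hb 0 (by omega)
          have hρ : spinalWord ω ρ (ρ b) w = w :=
            ih (ρ b) (fun i hi => hb (i + 1) (by omega)) w (by simpa using hu)
          simp [spinalWord, hω, hρ, shiftWord_zero]
      have h2 : ∀ n (b : ℕ → ZMod p), b n = 1 →
          spinalWord ω ρ b (List.replicate n (-1) ++ [0, 0]) =
            List.replicate n (-1) ++ [0, 1] := by
        intro n
        induction n with
        | zero =>
          intro b hb
          have hω : ω b = 1 := hb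
          simp [spinalWord, hω, shiftWord]
        | succ n ih =>
          intro b hb
          have := ih (ρ b) hb
          simp [List.replicate_succ, spinalWord, this]
      refine ⟨spinal ω ρ (Pi.single n 1), fun u hu => ?_, fun h => ?_⟩
      · exact h1 n _ (fun i hi => by simp [Pi.single_apply, hi.ne]) u hu
      · have h3 := h2 n (Pi.single n 1) (by simp)
        have h4 : spinalWord ω ρ (Pi.single n 1) (List.replicate n (-1) ++ [0, 0]) =
            List.replicate n (-1) ++ [0, 0] := h _ (by simp)
        rw [h3] at h4
        simp at h4
  obtain ⟨g, hg, hg'⟩ := key n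
  exact lt_of_le_of_ne (levelStab_succ_le p n) fun h => hg' (h ▸ hg)

/-- The index `[A(p) : A(p)_n]`. -/
noncomputable def levelIndex (n : ℕ) : ℕ := (levelStab p n).index

theorem levelIndex_strictMono : StrictMono (levelIndex p) :=
  strictMono_nat_of_lt_succ fun n => Subgroup.index_strictAnti (levelStab_succ_lt p n)

theorem levelIndex_pos (n : ℕ) : 0 < levelIndex p n :=
  Nat.pos_of_ne_zero Subgroup.FiniteIndex.index_ne_zero

variable {p}

/-- The set of the numbers `1 / [A(p) : A(p)_n]`, over all `n` with `f⁻¹ g ∈ A(p)_n`. -/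
def distSet (f g : PAdicAut p) : Set ℝ :=
  {r | ∃ n, f⁻¹ * g ∈ levelStab p n ∧ r = 1 / (levelIndex p n : ℝ)}

theorem distSet_nonempty (f g : PAdicAut p) : (distSet f g).Nonempty :=
  ⟨_, 0, by simp [levelStab_zero], rfl⟩

theorem distSet_bddBelow (f g : PAdicAut p) : BddBelow (distSet f g) :=
  ⟨0, by rintro _ ⟨n, -, rfl⟩; positivity⟩

theorem one_div_levelIndex_lt {k n : ℕ} :
    1 / (levelIndex p k : ℝ) < 1 / (levelIndex p n : ℝ) ↔ n < k := by
  have hk : (0 : ℝ) < levelIndex p k := by exact_mod_cast levelIndex_pos p k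
  have hn : (0 : ℝ) < levelIndex p n := by exact_mod_cast levelIndex_pos p n
  rw [one_div_lt_one_div hk hn, Nat.cast_lt, (levelIndex_strictMono p).lt_iff_lt]

theorem sInf_distSet_lt {f g : PAdicAut p} {n : ℕ}
    (h : sInf (distSet f g) < 1 / (levelIndex p n : ℝ)) : f⁻¹ * g ∈ levelStab p n := by
  obtain ⟨_, ⟨k, hk, rfl⟩, hlt⟩ := exists_lt_of_csInf_lt (distSet_nonempty f g) h
  exact levelStab_antitone p (one_div_levelIndex_lt.1 hlt).le hk

theorem distSet_mul_left (h f g : PAdicAut p) : distSet (h * f) (h * g) = distSet f g := by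
  simp [distSet, mul_assoc]

theorem distSet_mul_right (h f g : PAdicAut p) : distSet (f * h) (g * h) = distSet f g := by
  have : ∀ n, (f * h)⁻¹ * (g * h) ∈ levelStab p n ↔ f⁻¹ * g ∈ levelStab p n := fun n => by
    have := (levelStab_normal p n).mem_comm_iff (a := h⁻¹) (b := f⁻¹ * g * h)
    simpa [mul_assoc] using this
  simp only [distSet, this]

theorem distSet_comm (f g : PAdicAut p) : distSet f g = distSet g f := by
  have : ∀ n, f⁻¹ * g ∈ levelStab p n ↔ g⁻¹ * f ∈ levelStab p n := fun n => by
    rw [← inv_mem_iff]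
    simp
  simp only [distSet, this]

/-- The natural metric on `A(p)`, derived from the filtration of `A(p)` by its own level
stabilizers: `d(f, g) = inf {1 / [A(p) : A(p)_n] | f⁻¹ g ∈ A(p)_n}`. -/
noncomputable instance : MetricSpace (PAdicAut p) where
  dist f g := sInf (distSet f g)
  dist_self f := by
    refine le_antisymm (le_of_forall_pos_lt_add fun ε hε => ?_)
      (le_csInf (distSet_nonempty f f) ?_)
    · obtain ⟨n, hn⟩ := exists_nat_one_div_lt hε
      have h1 : ((n + 1 : ℕ) : ℝ) ≤ levelIndex p (n + 1) := by
        exact_mod_cast (levelIndex_strictMono p).id_le (n + 1)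
      have h2 : 1 / (levelIndex p (n + 1) : ℝ) ≤ 1 / ((n : ℝ) + 1) := by
        have h3 : (0 : ℝ) < (n : ℝ) + 1 := by positivity
        push_cast at h1
        exact one_div_le_one_div_of_le h3 h1
      have h4 := csInf_le (distSet_bddBelow f f) ⟨n + 1, by simp, rfl⟩
      linarith
    · rintro _ ⟨n, -, rfl⟩
      positivity
  dist_comm f g := by rw [distSet_comm]
  dist_triangle f g h := by
    have key : ∀ a ∈ distSet f g, ∀ b ∈ distSet g h, sInf (distSet f h) ≤ a + b := by
      rintro _ ⟨n, hn, rfl⟩ _ ⟨k, hk, rfl⟩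
      have hn0 : (0 : ℝ) ≤ 1 / (levelIndex p n : ℝ) := by positivity
      have hk0 : (0 : ℝ) ≤ 1 / (levelIndex p k : ℝ) := by positivity
      have hprod : f⁻¹ * h = (f⁻¹ * g) * (g⁻¹ * h) := by group
      rcases le_total n k with hnk | hnk
      · have := csInf_le (distSet_bddBelow f h)
          ⟨n, by rw [hprod]; exact mul_mem hn (levelStab_antitone p hnk hk), rfl⟩
        linarith
      · have := csInf_le (distSet_bddBelow f h)
          ⟨k, by rw [hprod]; exact mul_mem (levelStab_antitone p hnk hn) hk, rfl⟩
        linarith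
    have h1 : ∀ a ∈ distSet f g, sInf (distSet f h) - a ≤ sInf (distSet g h) := fun a ha =>
      le_csInf (distSet_nonempty g h) fun b hb => by linarith [key a ha b hb]
    have h2 : sInf (distSet f h) - sInf (distSet g h) ≤ sInf (distSet f g) :=
      le_csInf (distSet_nonempty f g) fun a ha => by linarith [h1 a ha]
    linarith
  eq_of_dist_eq_zero := fun {f g} h => by
    have hall : ∀ n, f⁻¹ * g ∈ levelStab p n := fun n => by
      refine sInf_distSet_lt ?_
      have hn : (0 : ℝ) < levelIndex p n := by exact_mod_cast levelIndex_pos p n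
      have h' : sInf (distSet f g) = 0 := h
      rw [h']
      positivity
    have h1 : f⁻¹ * g = 1 := act_ext fun u => hall u.length u rfl
    exact inv_mul_eq_one.1 h1

theorem dist_def (f g : PAdicAut p) : dist f g = sInf (distSet f g) := rfl

instance : IsTopologicalGroup (PAdicAut p) where
  continuous_mul := by
    refine Metric.continuous_iff.2 fun ⟨f, g⟩ ε hε => ⟨ε / 2, by positivity, fun ⟨f', g'⟩ h => ?_⟩
    rw [Prod.dist_eq, max_lt_iff] at h
    have h1 : dist (f' * g') (f * g') = dist f' f := by
      rw [dist_def, dist_def, distSet_mul_right]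
    have h2 : dist (f * g') (f * g) = dist g' g := by
      rw [dist_def, dist_def, distSet_mul_left]
    have := dist_triangle (f' * g') (f * g') (f * g)
    have h3 := h.1
    have h4 := h.2
    simp only at h3 h4 ⊢
    linarith
  continuous_inv := by
    refine Isometry.continuous (Isometry.of_dist_eq fun f g => ?_)
    rw [dist_def, dist_def, ← distSet_mul_left f, ← distSet_mul_right g]
    simp [distSet_comm g f]

/-- A subgroup of `A(p)` is topologically finitely generated if it is the closure of a subgroup
generated by a finite set. -/
def IsTopologicallyFG (H : Subgroup (PAdicAut p)) : Prop :=
  ∃ S : Set (PAdicAut p), S.Finite ∧ (Subgroup.closure S).topologicalClosure = H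

end Metric

end PAdicTree

/-!
The dimension is read off from the exact sizes of the congruence quotients of the group, and these
come from a description of the activities that an element fixing level `k` may have on that level.

Write `G` for the group generated by `a` and `B`, and `m = d + 1` for the degree. For a subgroup
`S`, the elements of `S` that fix level `k` realize on it an additive group of functions
`levelFunctions S k` with values in `ZMod p`, and `|S : S_n|` is the product of the sizes of these
groups for `k < n` (`relIndex_succ`). For all of `A(p)` every function is realized. For `G`:

* *Upper bound.* Each `b : B` acts as `ρ(b)` below the letter `p - 1` and as `a ^ ω(b)` below the
  letter `0`. Since `ω ∘ ρ⁻¹` is a combination of the functionals `ω ρ^j`, `j ≤ d`, which are total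
  activities on levels, the sections at neighbouring letters of an element of `G` satisfy a linear
  relation (`rootActv_sec_add_one`). On level `d + 2` it forces the sum of the activities over the
  subtree of each letter to vanish. For `p = 2` the two sections have images in the dihedral group
  of order eight that correspond under its outer automorphism (`centralCoord_sec_one`), and this
  forces one more linear condition, so that the sums over the four subtrees of level two agree.
  There are thus `p`, respectively three, linear conditions. Self-similarity then bounds all deeper
  levels.

* *Lower bound.* Let `N` be the normal closure in `G` of the commutators `[a, c]`, where `c` ranges
  over `B` for odd `p` and over `ρ(ker ω)` for `p = 2`. For `ω(b) = k` and `ρ(b') = c` the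
  commutator of `b` with `a b' a⁻¹` acts as `[a ^ k, c]` below the letter `0` and trivially
  elsewhere, and it lies in `N`; hence `N` contains the product of `p` copies of itself acting on
  the subtrees of level one (`ofSec_mem_branchSubgroup`). Elements of `B` that are active at a
  single vertex of a level, conjugated by the level-transitive group `G`, yield in `N` all functions
  of sum zero on a level; through the branching this gives everything that the linear conditions
  on level `d + 2` allow when `p` is odd. When `p = 2` it gives the functions with four vanishing
  sums, and the commutator of a suitable `b` with `a b a⁻¹` supplies one with four sums `1`.

Both bounds agree, so `|G : G_n|` is a constant times `[A(p) : A(p)_n] ^ D` for `n ≥ d + 2`, where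
`D = 1 - t / p ^ (m + 1)` (`relIndex_topologicalClosure`); the closure of `G` has the same
congruence quotients. The coverings by cosets of the level stabilizers show that the
`D`-dimensional Hausdorff measure of the closure is finite, and comparison with the Haar measure of
the compact closure shows that it is not zero (`dimH_eq_of_relIndex`).
-/

namespace PAdicTree

open scoped commutatorElement

/-! ### Portraits and sections -/

section Portrait

variable {p : ℕ}

/-- The activity of `g` at the vertex `u`: the `k` such that `g` maps `u x` to `g(u) (x + k)`. -/
noncomputable def actv (g : PAdicAut p) (u : List (ZMod p)) : ZMod p :=
  (exists_act_append g u).choose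

theorem act_append_singleton (g : PAdicAut p) (u : List (ZMod p)) (x : ZMod p) :
    g.act (u ++ [x]) = g.act u ++ [x + actv g u] :=
  (exists_act_append g u).choose_spec x

theorem actv_eq_of_act {g : PAdicAut p} {u : List (ZMod p)} {x k : ZMod p}
    (h : g.act (u ++ [x]) = g.act u ++ [x + k]) : actv g u = k := by
  rw [act_append_singleton] at h
  simpa using h

theorem ext_actv {g h : PAdicAut p} (H : ∀ u, actv g u = actv h u) : g = h := by
  refine act_ext fun u => ?_
  induction u using List.reverseRecOn with
  | nil => simp [act_nil]
  | append_singleton u x ih => rw [act_append_singleton, act_append_singleton, ih, H]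

theorem actv_mul (g h : PAdicAut p) (u : List (ZMod p)) :
    actv (g * h) u = actv g (h.act u) + actv h u := by
  refine actv_eq_of_act (x := 0) ?_
  rw [act_mul, act_append_singleton h, act_append_singleton g, act_mul, add_assoc,
    add_comm (actv h u)]

@[simp] theorem actv_one (u : List (ZMod p)) : actv (1 : PAdicAut p) u = 0 :=
  actv_eq_of_act (x := 0) (by simp)

theorem actv_inv (g : PAdicAut p) (u : List (ZMod p)) : actv g⁻¹ u = -actv g (g⁻¹.act u) := by
  have := actv_mul g g⁻¹ u
  rw [mul_inv_cancel, actv_one] at this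
  exact (neg_eq_of_add_eq_zero_right this.symm).symm

/-- The map on words whose activity at the vertex `u` is `φ u`. -/
def portraitWord : (List (ZMod p) → ZMod p) → List (ZMod p) → List (ZMod p)
  | _, [] => []
  | φ, x :: w => (x + φ []) :: portraitWord (fun v => φ (x :: v)) w

/-- The inverse of `portraitWord φ`. -/
def portraitWordInv : (List (ZMod p) → ZMod p) → List (ZMod p) → List (ZMod p)
  | _, [] => []
  | φ, y :: w => (y - φ []) :: portraitWordInv (fun v => φ ((y - φ []) :: v)) w

theorem portraitWord_append (φ : List (ZMod p) → ZMod p) (u : List (ZMod p)) (x : ZMod p) :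
    portraitWord φ (u ++ [x]) = portraitWord φ u ++ [x + φ u] := by
  induction u generalizing φ with
  | nil => simp [portraitWord]
  | cons y w ih => simp [portraitWord, ih]

/-- The automorphism with prescribed activities `φ`. -/
def ofPortrait (φ : List (ZMod p) → ZMod p) : PAdicAut p :=
  ⟨{ toFun := portraitWord φ
     invFun := portraitWordInv φ
     left_inv := fun u => by
      induction u generalizing φ with
      | nil => rfl
      | cons x w ih => simp [portraitWord, portraitWordInv, ih]
     right_inv := fun u => by
      induction u generalizing φ with
      | nil => rfl
      | cons x w ih => simp [portraitWord, portraitWordInv, ih] },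
   mem_padicAutSubgroup rfl fun u => ⟨φ u, fun x => portraitWord_append φ u x⟩⟩

theorem actv_ofPortrait (φ : List (ZMod p) → ZMod p) (u : List (ZMod p)) :
    actv (ofPortrait φ) u = φ u :=
  actv_eq_of_act (x := 0) (portraitWord_append φ u 0)

theorem ofPortrait_actv (g : PAdicAut p) : ofPortrait (actv g) = g :=
  ext_actv fun u => actv_ofPortrait _ u

/-- The activity of `g` at the root. -/
noncomputable def rootActv (g : PAdicAut p) : ZMod p := actv g []

/-- The section of `g` at the letter `x`. -/
noncomputable def sec (g : PAdicAut p) (x : ZMod p) : PAdicAut p :=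
  ofPortrait fun w => actv g (x :: w)

theorem actv_cons (g : PAdicAut p) (x : ZMod p) (w : List (ZMod p)) :
    actv g (x :: w) = actv (sec g x) w :=
  (actv_ofPortrait (fun w => actv g (x :: w)) w).symm

theorem act_cons (g : PAdicAut p) (x : ZMod p) (w : List (ZMod p)) :
    g.act (x :: w) = (x + rootActv g) :: (sec g x).act w := by
  conv_lhs => rw [← ofPortrait_actv g]
  rfl

theorem rootActv_mul (g h : PAdicAut p) : rootActv (g * h) = rootActv g + rootActv h := by
  simp [rootActv, actv_mul, act_nil]

@[simp] theorem rootActv_one : rootActv (1 : PAdicAut p) = 0 := actv_one _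

theorem rootActv_inv (g : PAdicAut p) : rootActv g⁻¹ = -rootActv g := by
  simp [rootActv, actv_inv, act_nil]

theorem sec_mul (g h : PAdicAut p) (x : ZMod p) :
    sec (g * h) x = sec g (x + rootActv h) * sec h x := by
  refine act_ext fun w => ?_
  have h1 := act_cons (g * h) x w
  rw [act_mul, act_cons h, act_cons g] at h1
  rw [act_mul]
  exact (List.cons.inj h1).2.symm

@[simp] theorem sec_one (x : ZMod p) : sec (1 : PAdicAut p) x = 1 :=
  ext_actv fun u => by rw [← actv_cons, actv_one, actv_one]

theorem sec_inv (g : PAdicAut p) (x : ZMod p) : sec g⁻¹ x = (sec g (x - rootActv g))⁻¹ := by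
  have h := sec_mul g g⁻¹ x
  rw [mul_inv_cancel, sec_one, rootActv_inv, ← sub_eq_add_neg] at h
  exact (inv_eq_of_mul_eq_one_right h.symm).symm

theorem ext_sec {g h : PAdicAut p} (h0 : rootActv g = rootActv h)
    (h1 : ∀ x, sec g x = sec h x) : g = h := by
  refine ext_actv fun u => ?_
  cases u with
  | nil => exact h0
  | cons x w => rw [actv_cons, actv_cons, h1]

/-- The portrait with zero at the root and the activities of `s x` below the letter `x`. -/
noncomputable def secPortrait (s : ZMod p → PAdicAut p) : List (ZMod p) → ZMod p
  | [] => 0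
  | x :: w => actv (s x) w

/-- The embedding `(g_x)_x ↦ (g_0, …, g_{p-1})` of the product of `p` copies of `A(p)` into
`A(p)`. -/
noncomputable def ofSec : (ZMod p → PAdicAut p) →* PAdicAut p where
  toFun s := ofPortrait (secPortrait s)
  map_one' := ext_actv fun u => by
    rw [actv_ofPortrait]
    cases u <;> simp [secPortrait]
  map_mul' s t := by
    have hr : ∀ s : ZMod p → PAdicAut p, rootActv (ofPortrait (secPortrait s)) = 0 := fun s =>
      actv_ofPortrait _ _
    have hs : ∀ (s : ZMod p → PAdicAut p) x, sec (ofPortrait (secPortrait s)) x = s x :=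
      fun s x => ext_actv fun u => by rw [← actv_cons, actv_ofPortrait]; rfl
    refine ext_sec ?_ fun x => ?_
    · rw [rootActv_mul]
      simp [hr]
    · rw [sec_mul]
      simp [hr, hs]

@[simp] theorem rootActv_ofSec (s : ZMod p → PAdicAut p) : rootActv (ofSec s) = 0 :=
  actv_ofPortrait _ _

@[simp] theorem sec_ofSec (s : ZMod p → PAdicAut p) (x : ZMod p) : sec (ofSec s) x = s x :=
  ext_actv fun u => by rw [← actv_cons]; exact actv_ofPortrait _ _

theorem mem_levelStab_succ_iff_sec {n : ℕ} {g : PAdicAut p} :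
    g ∈ levelStab p (n + 1) ↔ rootActv g = 0 ∧ ∀ x, sec g x ∈ levelStab p n := by
  constructor
  · intro hg
    have key : ∀ (x : ZMod p) (w : List (ZMod p)), w.length = n →
        x + rootActv g = x ∧ (sec g x).act w = w := fun x w hw => by
      have := hg (x :: w) (by simp [hw])
      rw [act_cons] at this
      simpa using this
    refine ⟨?_, fun x w hw => (key x w hw).2⟩
    simpa using (key 0 (List.replicate n 0) (by simp)).1
  · rintro ⟨h0, h1⟩ u hu
    obtain ⟨x, w, rfl⟩ := List.exists_cons_of_length_eq_add_one hu
    rw [act_cons, h0, add_zero, h1 x w (by simpa using hu)]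

theorem mem_levelStab_succ_iff_actv {n : ℕ} {g : PAdicAut p} :
    g ∈ levelStab p (n + 1) ↔ g ∈ levelStab p n ∧ ∀ u, u.length = n → actv g u = 0 := by
  have key : ∀ u : List (ZMod p), g.act u = u → (g.act (u ++ [0]) = u ++ [0] ↔ actv g u = 0) := by
    intro u hu
    rw [act_append_singleton, hu]
    simp
  constructor
  · intro hg
    have h0 : g ∈ levelStab p n := by
      intro u hu
      have := hg (u ++ [0]) (by simp [hu])
      rw [act_append_singleton] at this
      exact (List.append_inj this (by rw [length_act])).1
    exact ⟨h0, fun u hu => (key u (h0 u hu)).1 (hg _ (by simp [hu]))⟩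
  · rintro ⟨h0, h1⟩ u hu
    induction u using List.reverseRecOn with
    | nil => simp at hu
    | append_singleton u x _ =>
      have hu' : u.length = n := by simpa using hu
      rw [act_append_singleton, h0 u hu', h1 u hu', add_zero]

theorem mem_levelStab_iff_actv {n : ℕ} {g : PAdicAut p} :
    g ∈ levelStab p n ↔ ∀ u, u.length < n → actv g u = 0 := by
  induction n with
  | zero =>
    simp only [Nat.not_lt_zero, false_imp_iff, implies_true, iff_true]
    intro u hu
    rw [List.length_eq_zero_iff.1 hu, act_nil]
  | succ n ih =>
    rw [mem_levelStab_succ_iff_actv, ih]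
    constructor
    · rintro ⟨h0, h1⟩ u hu
      rcases Nat.lt_succ_iff_lt_or_eq.1 hu with h | h
      exacts [h0 u h, h1 u h]
    · exact fun h => ⟨fun u hu => h u (by omega), fun u hu => h u (by omega)⟩

theorem rootActv_eq_zero_of_mem {n : ℕ} {g : PAdicAut p} (hg : g ∈ levelStab p (n + 1)) :
    rootActv g = 0 := (mem_levelStab_succ_iff_sec.1 hg).1

theorem sec_mem_levelStab {n : ℕ} {g : PAdicAut p} (hg : g ∈ levelStab p (n + 1)) (x : ZMod p) :
    sec g x ∈ levelStab p n := (mem_levelStab_succ_iff_sec.1 hg).2 x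

theorem ofSec_mem_levelStab {n : ℕ} {s : ZMod p → PAdicAut p} (h : ∀ x, s x ∈ levelStab p n) :
    ofSec s ∈ levelStab p (n + 1) :=
  mem_levelStab_succ_iff_sec.2 ⟨by simp, by simpa using h⟩

/-- Conjugation moves the activities of an element of the level stabilizer. -/
theorem actv_conj {n : ℕ} {g : PAdicAut p} (hg : g ∈ levelStab p n) (h : PAdicAut p)
    {u : List (ZMod p)} (hu : u.length = n) :
    actv (h * g * h⁻¹) u = actv g (h⁻¹.act u) := by
  have h1 : g.act (h⁻¹.act u) = h⁻¹.act u := hg _ (by rw [length_act, hu])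
  rw [actv_mul, actv_mul, h1, actv_inv]
  ring

end Portrait

section Generators

variable {p : ℕ}

@[simp] theorem rootActv_rootShift (k : ZMod p) : rootActv (rootShift p k) = k :=
  actv_eq_of_act (x := 0) rfl

@[simp] theorem sec_rootShift (k x : ZMod p) : sec (rootShift p k) x = 1 := by
  refine act_ext fun w => ?_
  have h : (rootShift p k).act (x :: w) = (x + k) :: w := rfl
  rw [act_cons] at h
  exact (List.cons.inj h).2

theorem rootShift_add (k l : ZMod p) : rootShift p (k + l) = rootShift p k * rootShift p l :=
  ext_sec (by simp [rootActv_mul]) (by simp [sec_mul])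

@[simp] theorem rootShift_zero : rootShift p 0 = 1 := ext_sec (by simp) (by simp)

variable {B : Type*} [AddCommGroup B] [Module (ZMod p) B]
variable (ω : B →ₗ[ZMod p] ZMod p) (ρ : B →ₗ[ZMod p] B)

@[simp] theorem rootActv_spinal (b : B) : rootActv (spinal ω ρ b) = 0 := by
  refine actv_eq_of_act (x := 0) ?_
  have h : (spinal ω ρ b).act [0] = 0 :: shiftWord (ω b) [] := by
    change spinalWord ω ρ b [0] = _
    simp [spinalWord]
  simpa [act_nil, shiftWord] using h

theorem spinal_act_cons (b : B) (x : ZMod p) (w : List (ZMod p)) :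
    (spinal ω ρ b).act (x :: w) =
      if x = 0 then x :: (rootShift p (ω b)).act w
      else if x = -1 then x :: (spinal ω ρ (ρ b)).act w
      else x :: w := rfl

@[simp] theorem sec_spinal_zero (b : B) : sec (spinal ω ρ b) 0 = rootShift p (ω b) := by
  refine act_ext fun w => ?_
  have h := spinal_act_cons ω ρ b 0 w
  rw [act_cons, if_pos rfl] at h
  exact (List.cons.inj h).2

@[simp] theorem sec_spinal_neg_one [Fact p.Prime] (b : B) :
    sec (spinal ω ρ b) (-1) = spinal ω ρ (ρ b) := by
  refine act_ext fun w => ?_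
  have h := spinal_act_cons ω ρ b (-1) w
  rw [act_cons, if_neg (by simp), if_pos rfl] at h
  exact (List.cons.inj h).2

theorem sec_spinal_of_ne (b : B) {x : ZMod p} (h0 : x ≠ 0) (h1 : x ≠ -1) :
    sec (spinal ω ρ b) x = 1 := by
  refine act_ext fun w => ?_
  have h := spinal_act_cons ω ρ b x w
  rw [act_cons, if_neg h0, if_neg h1] at h
  exact (List.cons.inj h).2

theorem spinal_add (b c : B) : spinal ω ρ (b + c) = spinal ω ρ b * spinal ω ρ c :=
  act_ext fun u => by
    rw [add_comm]
    exact (spinalWord_spinalWord ω ρ b c u).symm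

@[simp] theorem spinal_zero : spinal ω ρ (0 : B) = 1 := act_ext fun u => spinalWord_zero ω ρ u

theorem rootShift_mem (k : ZMod p) : rootShift p k ∈ spinalGroup ω ρ :=
  Subgroup.subset_closure (Or.inl ⟨k, rfl⟩)

theorem spinal_mem (b : B) : spinal ω ρ b ∈ spinalGroup ω ρ :=
  Subgroup.subset_closure (Or.inr ⟨b, rfl⟩)

/-- The group `G_{ω,ρ}` is self-similar. -/
theorem sec_mem [Fact p.Prime] {g : PAdicAut p} (hg : g ∈ spinalGroup ω ρ) (x : ZMod p) :
    sec g x ∈ spinalGroup ω ρ := by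
  induction hg using Subgroup.closure_induction generalizing x with
  | mem g hg =>
    rcases hg with ⟨k, rfl⟩ | ⟨b, rfl⟩
    · simp
    · by_cases h0 : x = 0
      · subst h0
        simpa using rootShift_mem ω ρ _
      by_cases h1 : x = -1
      · subst h1
        simpa using spinal_mem ω ρ _
      · rw [sec_spinal_of_ne ω ρ b h0 h1]
        exact one_mem _
  | one => simp
  | mul g h _ _ ihg ihh =>
    rw [sec_mul]
    exact mul_mem (ihg _) (ihh _)
  | inv g _ ih =>
    rw [sec_inv]
    exact inv_mem (ih _)

end Generators

/-! ### Total activities on the levels -/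

section Sigma

variable {p : ℕ} [Fact p.Prime]

/-- The sum of the activities of `g` over all vertices of level `k`. -/
noncomputable def sigma : ℕ → PAdicAut p → ZMod p
  | 0, g => rootActv g
  | k + 1, g => ∑ x, sigma k (sec g x)

theorem sigma_mul (k : ℕ) (g h : PAdicAut p) : sigma k (g * h) = sigma k g + sigma k h := by
  induction k generalizing g h with
  | zero => exact rootActv_mul g h
  | succ k ih =>
    simp only [sigma, sec_mul, ih, Finset.sum_add_distrib]
    congr 1
    exact Fintype.sum_equiv (Equiv.addRight (rootActv h)) _ _ fun x => rfl

@[simp] theorem sigma_one (k : ℕ) : sigma k (1 : PAdicAut p) = 0 := by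
  simpa using sigma_mul k (1 : PAdicAut p) 1

theorem sigma_eq_zero_of_mem {k n : ℕ} (hkn : k < n) {g : PAdicAut p} (hg : g ∈ levelStab p n) :
    sigma k g = 0 := by
  induction k generalizing g n with
  | zero =>
    obtain ⟨n, rfl⟩ := Nat.exists_eq_succ_of_ne_zero (by omega : n ≠ 0)
    exact rootActv_eq_zero_of_mem hg
  | succ k ih =>
    obtain ⟨n, rfl⟩ := Nat.exists_eq_succ_of_ne_zero (by omega : n ≠ 0)
    exact Finset.sum_eq_zero fun x _ => ih (by omega) (sec_mem_levelStab hg x)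

theorem sigma_rootShift (j : ℕ) (k : ZMod p) : sigma (j + 1) (rootShift p k) = 0 := by
  simp [sigma]

variable {B : Type*} [AddCommGroup B] [Module (ZMod p) B]
variable (ω : B →ₗ[ZMod p] ZMod p) (ρ : B →ₗ[ZMod p] B)

theorem sigma_succ_spinal_eq (j : ℕ) (b : B) : sigma (j + 1) (spinal ω ρ b) =
    sigma j (rootShift p (ω b)) + sigma j (spinal ω ρ (ρ b)) := by
  have h01 : (0 : ZMod p) ≠ -1 := by simp
  rw [sigma, ← Finset.sum_subset (Finset.subset_univ {0, -1}), Finset.sum_pair h01]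
  · simp
  · intro x _ hx
    simp only [Finset.mem_insert, Finset.mem_singleton, not_or] at hx
    rw [sec_spinal_of_ne ω ρ b hx.1 hx.2, sigma_one]

theorem sigma_succ_spinal (j : ℕ) (b : B) : sigma (j + 1) (spinal ω ρ b) = ω ((ρ ^ j) b) := by
  induction j generalizing b with
  | zero =>
    rw [sigma_succ_spinal_eq]
    simp [sigma]
  | succ j ih =>
    rw [sigma_succ_spinal_eq, sigma_rootShift, ih, zero_add, pow_succ]
    rfl

end Sigma

/-! ### The relations between the sections of an element of the group -/

section Relations

variable {p : ℕ} [Fact p.Prime]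

/-- The combination `∑ c_j σ_{j+1}` of the total activities. For the coefficients of `ω ρ⁻¹` it
takes the value `ω(b)` on `ρ(b)`. -/
noncomputable def weightedSum (c : ℕ → ZMod p) (m : ℕ) (g : PAdicAut p) : ZMod p :=
  ∑ j ∈ Finset.range m, c j * sigma (j + 1) g

/-- The combination `∑ c_j σ_j` of the total activities. -/
noncomputable def weightedSumShift (c : ℕ → ZMod p) (m : ℕ) (g : PAdicAut p) : ZMod p :=
  ∑ j ∈ Finset.range m, c j * sigma j g

theorem weightedSum_mul (c : ℕ → ZMod p) (m : ℕ) (g h : PAdicAut p) :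
    weightedSum c m (g * h) = weightedSum c m g + weightedSum c m h := by
  simp [weightedSum, sigma_mul, mul_add, Finset.sum_add_distrib]

theorem weightedSumShift_mul (c : ℕ → ZMod p) (m : ℕ) (g h : PAdicAut p) :
    weightedSumShift c m (g * h) = weightedSumShift c m g + weightedSumShift c m h := by
  simp [weightedSumShift, sigma_mul, mul_add, Finset.sum_add_distrib]

@[simp] theorem weightedSum_one (c : ℕ → ZMod p) (m : ℕ) : weightedSum c m 1 = 0 := by
  simp [weightedSum]

theorem weightedSum_inv (c : ℕ → ZMod p) (m : ℕ) (g : PAdicAut p) :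
    weightedSum c m g⁻¹ = -weightedSum c m g := by
  have := weightedSum_mul c m g g⁻¹
  rw [mul_inv_cancel, weightedSum_one] at this
  exact (neg_eq_of_add_eq_zero_right this.symm).symm

theorem weightedSum_eq_sum_weightedSumShift (c : ℕ → ZMod p) (m : ℕ) (g : PAdicAut p) :
    weightedSum c m g = ∑ x, weightedSumShift c m (sec g x) := by
  simp only [weightedSum, weightedSumShift, sigma, Finset.mul_sum]
  rw [Finset.sum_comm]

@[simp] theorem weightedSum_rootShift (c : ℕ → ZMod p) (m : ℕ) (k : ZMod p) :
    weightedSum c m (rootShift p k) = 0 := by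
  simp [weightedSum, sigma_rootShift]

variable {B : Type*} [AddCommGroup B] [Module (ZMod p) B]
variable (ω : B →ₗ[ZMod p] ZMod p) (ρ : B →ₗ[ZMod p] B)

/-- In `G_{ω,ρ}` the section at `x` determines the root activity of the section at `x + 1`: if
`b` contributes `ρ(b)` to the former, it contributes `a ^ ω(b)` to the latter. -/
theorem rootActv_sec_add_one {c : ℕ → ZMod p} {m : ℕ}
    (hc : ∀ b, ∑ j ∈ Finset.range m, c j * ω ((ρ ^ j) (ρ b)) = ω b)
    {g : PAdicAut p} (hg : g ∈ spinalGroup ω ρ) (x : ZMod p) :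
    rootActv (sec g (x + 1)) = weightedSum c m (sec g x) := by
  induction hg using Subgroup.closure_induction generalizing x with
  | mem g hg =>
    rcases hg with ⟨k, rfl⟩ | ⟨b, rfl⟩
    · simp
    · have h1 : rootActv (sec (spinal ω ρ b) (x + 1)) = if x = -1 then ω b else 0 := by
        split_ifs with h
        · simp [h]
        · have h0 : x + 1 ≠ 0 := fun h' => h (eq_neg_of_add_eq_zero_left h')
          by_cases h2 : x + 1 = -1
          · simp [h2]
          · simp [sec_spinal_of_ne ω ρ b h0 h2]
      have h2 : weightedSum c m (sec (spinal ω ρ b) x) = if x = -1 then ω b else 0 := by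
        split_ifs with h
        · simp [h, weightedSum, sigma_succ_spinal, hc]
        · by_cases h0 : x = 0
          · simp [h0]
          · simp [sec_spinal_of_ne ω ρ b h0 h]
      rw [h1, h2]
  | one => simp
  | mul g h _ _ ihg ihh =>
    rw [sec_mul, sec_mul, rootActv_mul, weightedSum_mul, ihh, ← ihg, add_right_comm]
  | inv g _ ih =>
    rw [sec_inv, sec_inv, rootActv_inv, weightedSum_inv, ← ih, sub_add_eq_add_sub]

/-- On level `d + 2` of an element that stabilizes it, only the leading term of the relation
between the sections is left. -/
theorem sigma_sec_eq_zero {c : ℕ → ZMod p} {d : ℕ}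
    (hc : ∀ b, ∑ j ∈ Finset.range (d + 1), c j * ω ((ρ ^ j) (ρ b)) = ω b) (hcd : c d ≠ 0)
    {g : PAdicAut p} (hg : g ∈ spinalGroup ω ρ) (hg' : g ∈ levelStab p (d + 2)) (x : ZMod p) :
    sigma (d + 1) (sec g x) = 0 := by
  have h := rootActv_sec_add_one ω ρ hc hg x
  rw [rootActv_eq_zero_of_mem (sec_mem_levelStab hg' (x + 1)), weightedSum, Finset.sum_range_succ,
    Finset.sum_eq_zero, zero_add] at h
  · exact (mul_eq_zero.1 h.symm).resolve_left hcd
  · intro j hj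
    rw [sigma_eq_zero_of_mem (n := d + 1) _ (sec_mem_levelStab hg' x), mul_zero]
    simpa using hj

theorem sigma_inv (k : ℕ) (g : PAdicAut p) : sigma k g⁻¹ = -sigma k g := by
  have := sigma_mul k g g⁻¹
  rw [mul_inv_cancel, sigma_one] at this
  exact (neg_eq_of_add_eq_zero_right this.symm).symm

end Relations

section Binary

/-- A coordinate of the image of `g` in the dihedral group of order eight, identified with the
unitriangular matrices of size three over `ZMod 2`: the entry in the corner. The other two entries
are `rootActv g` and `weightedSum c m g`. -/
noncomputable def centralCoord (c : ℕ → ZMod 2) (m : ℕ) (g : PAdicAut 2) : ZMod 2 :=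
  weightedSumShift c m (sec g 0) + c 0 * sigma 1 g

theorem sum_zmod_two (f : ZMod 2 → ZMod 2) : ∑ x, f x = f 0 + f 1 := Fin.sum_univ_two f

/-- Together with the additivity of `rootActv` and `weightedSum` this is the multiplication of
unitriangular matrices. -/
theorem centralCoord_mul (c : ℕ → ZMod 2) (m : ℕ) (g h : PAdicAut 2) :
    centralCoord c m (g * h) =
      centralCoord c m g + centralCoord c m h + rootActv h * weightedSum c m g := by
  have h1 : weightedSumShift c m (sec g (rootActv h)) =
      weightedSumShift c m (sec g 0) + rootActv h * weightedSum c m g := by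
    rw [weightedSum_eq_sum_weightedSumShift, sum_zmod_two]
    have h01 : rootActv h = 0 ∨ rootActv h = 1 := by
      generalize rootActv h = k
      revert k
      decide
    rcases h01 with h0 | h0 <;> rw [h0]
    · simp
    · rw [one_mul, ← add_assoc, CharTwo.add_self_eq_zero, zero_add]
  rw [centralCoord, sec_mul, zero_add, weightedSumShift_mul, h1, sigma_mul,
    centralCoord, centralCoord]
  ring

@[simp] theorem centralCoord_one (c : ℕ → ZMod 2) (m : ℕ) : centralCoord c m 1 = 0 := by
  simp [centralCoord, weightedSumShift]

@[simp] theorem centralCoord_rootShift (c : ℕ → ZMod 2) (m : ℕ) (k : ZMod 2) :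
    centralCoord c m (rootShift 2 k) = 0 := by
  simp [centralCoord, weightedSumShift, sigma_rootShift]

theorem centralCoord_inv (c : ℕ → ZMod 2) (m : ℕ) (g : PAdicAut 2) :
    centralCoord c m g⁻¹ = -centralCoord c m g + rootActv g * weightedSum c m g := by
  have h := centralCoord_mul c m g g⁻¹
  rw [mul_inv_cancel, centralCoord_one, rootActv_inv] at h
  linear_combination -h

variable {B : Type*} [AddCommGroup B] [Module (ZMod 2) B]
variable (ω : B →ₗ[ZMod 2] ZMod 2) (ρ : B →ₗ[ZMod 2] B)

@[simp] theorem centralCoord_spinal (c : ℕ → ZMod 2) (d : ℕ) (b : B) :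
    centralCoord c (d + 1) (spinal ω ρ b) = 0 := by
  rw [centralCoord, sec_spinal_zero, sigma_succ_spinal, weightedSumShift, Finset.sum_range_succ']
  simp [sigma, CharTwo.add_self_eq_zero]

/-- For `p = 2` the images of the two sections in the dihedral group of order eight correspond
under the automorphism that exchanges its two generating involutions. -/
theorem centralCoord_sec_one {c : ℕ → ZMod 2} {d : ℕ}
    (hc : ∀ b, ∑ j ∈ Finset.range (d + 1), c j * ω ((ρ ^ j) (ρ b)) = ω b)
    {g : PAdicAut 2} (hg : g ∈ spinalGroup ω ρ) :
    centralCoord c (d + 1) (sec g 1) =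
      centralCoord c (d + 1) (sec g 0) + rootActv (sec g 0) * weightedSum c (d + 1) (sec g 0) := by
  have hrel : ∀ g ∈ spinalGroup ω ρ, rootActv (sec g 1) = weightedSum c (d + 1) (sec g 0) ∧
      weightedSum c (d + 1) (sec g 1) = rootActv (sec g 0) := fun g hg =>
    ⟨by simpa using rootActv_sec_add_one ω ρ hc hg 0,
      (rootActv_sec_add_one ω ρ hc hg 1).symm⟩
  have h01 : ∀ k : ZMod 2, k = 0 ∨ k = 1 := by decide
  have e2 : (1 + 1 : ZMod 2) = 0 := by decide
  have e3 : (0 - 1 : ZMod 2) = 1 := by decide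
  induction hg using Subgroup.closure_induction with
  | mem g hg =>
    rcases hg with ⟨k, rfl⟩ | ⟨b, rfl⟩
    · simp
    · have h1 : sec (spinal ω ρ b) 1 = spinal ω ρ (ρ b) := sec_spinal_neg_one ω ρ b
      simp [h1]
  | one => simp
  | mul g h hg hh Hg Hh =>
    obtain ⟨g1, g2⟩ := hrel g hg
    obtain ⟨h1, h2⟩ := hrel h hh
    rcases h01 (rootActv h) with h0 | h0 <;>
      simp only [sec_mul, h0, add_zero, zero_add, e2, centralCoord_mul, rootActv_mul,
        weightedSum_mul, Hg, Hh,
        h1, g1, g2] <;>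
      generalize rootActv (sec g 0) = a1 <;>
      generalize rootActv (sec h 0) = a2 <;>
      generalize weightedSum c (d + 1) (sec g 0) = l1 <;>
      generalize weightedSum c (d + 1) (sec h 0) = l2 <;>
      generalize centralCoord c (d + 1) (sec g 0) = t1 <;>
      generalize centralCoord c (d + 1) (sec h 0) = t2 <;>
      clear * - <;> decide +revert
  | inv g hg Hg =>
    obtain ⟨g1, g2⟩ := hrel g hg
    rcases h01 (rootActv g) with h0 | h0 <;>
      simp only [sec_inv, h0, sub_zero, sub_self, e3, centralCoord_inv, rootActv_inv,
        weightedSum_inv, Hg,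
        g1, g2] <;>
      generalize rootActv (sec g 0) = a1 <;>
      generalize weightedSum c (d + 1) (sec g 0) = l1 <;>
      generalize centralCoord c (d + 1) (sec g 0) = t1 <;>
      clear * - <;> decide +revert

/-- For `p = 2` the total activities on level `d` of the four sections at the words of length two
agree, if the element stabilizes level `d + 2`: all other terms in the relation of
`centralCoord_sec_one` vanish. -/
theorem sigma_sec_sec_eq {c : ℕ → ZMod 2} {d : ℕ} (hd : 1 ≤ d)
    (hc : ∀ b, ∑ j ∈ Finset.range (d + 1), c j * ω ((ρ ^ j) (ρ b)) = ω b) (hcd : c d ≠ 0)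
    {g : PAdicAut 2} (hg : g ∈ spinalGroup ω ρ) (hg' : g ∈ levelStab 2 (d + 2)) (x y : ZMod 2) :
    sigma d (sec (sec g x) y) = sigma d (sec (sec g 0) 0) := by
  have h01 : ∀ k : ZMod 2, k = 0 ∨ k = 1 := by decide
  have hcd1 : c d = 1 := (h01 (c d)).resolve_left hcd
  have hx : ∀ x, sigma d (sec (sec g x) 1) = sigma d (sec (sec g x) 0) := fun x => by
    have h := sigma_sec_eq_zero ω ρ hc hcd hg hg' x
    rw [sigma, sum_zmod_two, CharTwo.add_eq_zero] at h
    exact h.symm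
  have hgam : ∀ x, centralCoord c (d + 1) (sec g x) = sigma d (sec (sec g x) 0) := fun x => by
    rw [centralCoord, sigma_eq_zero_of_mem (n := d + 1) (by omega) (sec_mem_levelStab hg' x),
      mul_zero, add_zero, weightedSumShift, Finset.sum_range_succ, Finset.sum_eq_zero, zero_add,
      hcd1, one_mul]
    intro j hj
    rw [sigma_eq_zero_of_mem (n := d) _ (sec_mem_levelStab (sec_mem_levelStab hg' x) 0), mul_zero]
    simpa using hj
  have h10 : sigma d (sec (sec g 1) 0) = sigma d (sec (sec g 0) 0) := by
    rw [← hgam, ← hgam, centralCoord_sec_one ω ρ hc hg,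
      rootActv_eq_zero_of_mem (sec_mem_levelStab hg' 0), zero_mul, add_zero]
  rcases h01 x with rfl | rfl <;> rcases h01 y with rfl | rfl
  · rfl
  · exact hx 0
  · exact h10
  · rw [hx 1, h10]

end Binary

/-! ### Transitivity and lifting of sections -/

section Lifting

variable {p : ℕ} [Fact p.Prime]

theorem sec_conj_rootShift (k : ZMod p) (g : PAdicAut p) (x : ZMod p) :
    sec (rootShift p k * g * (rootShift p k)⁻¹) x = sec g (x - k) := by
  simp [sec_mul, sec_inv, rootActv_inv, sub_eq_add_neg]

theorem rootActv_conj (h g : PAdicAut p) : rootActv (h * g * h⁻¹) = rootActv g := by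
  rw [rootActv_mul, rootActv_mul, rootActv_inv]
  ring

theorem sec_commutator {g h : PAdicAut p} (hg : rootActv g = 0) (hh : rootActv h = 0)
    (x : ZMod p) : sec ⁅g, h⁆ x = ⁅sec g x, sec h x⁆ := by
  simp [commutatorElement_def, sec_mul, sec_inv, rootActv_inv, hg, hh]

@[simp] theorem rootActv_commutator (g h : PAdicAut p) : rootActv ⁅g, h⁆ = 0 := by
  simp only [commutatorElement_def, rootActv_mul, rootActv_inv]
  ring

variable {B : Type*} [AddCommGroup B] [Module (ZMod p) B]
variable {ω : B →ₗ[ZMod p] ZMod p} {ρ : B →ₗ[ZMod p] B}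

/-- The group is self-replicating: the sections at `0` of the stabilizer of level one fill it. -/
theorem exists_sec_zero_eq (hω : Function.Surjective ω) (hρ : Function.Surjective ρ)
    {h : PAdicAut p} (hh : h ∈ spinalGroup ω ρ) :
    ∃ g ∈ spinalGroup ω ρ, rootActv g = 0 ∧ sec g 0 = h := by
  induction hh using Subgroup.closure_induction with
  | mem g hg =>
    rcases hg with ⟨k, rfl⟩ | ⟨b, rfl⟩
    · obtain ⟨b, rfl⟩ := hω k
      exact ⟨spinal ω ρ b, spinal_mem ω ρ b, by simp, by simp⟩
    · obtain ⟨b, rfl⟩ := hρ b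
      refine ⟨rootShift p 1 * spinal ω ρ b * (rootShift p 1)⁻¹,
        mul_mem (mul_mem (rootShift_mem ω ρ 1) (spinal_mem ω ρ b))
          (inv_mem (rootShift_mem ω ρ 1)), ?_, ?_⟩
      · rw [rootActv_conj, rootActv_spinal]
      · rw [sec_conj_rootShift, zero_sub, sec_spinal_neg_one]
  | one => exact ⟨1, one_mem _, by simp, by simp⟩
  | mul g h _ _ ihg ihh =>
    obtain ⟨g', hg, hg0, rfl⟩ := ihg
    obtain ⟨h', hh, hh0, rfl⟩ := ihh
    exact ⟨g' * h', mul_mem hg hh, by rw [rootActv_mul, hg0, hh0, add_zero],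
      by rw [sec_mul, hh0, add_zero]⟩
  | inv g _ ih =>
    obtain ⟨g', hg, hg0, rfl⟩ := ih
    exact ⟨g'⁻¹, inv_mem hg, by rw [rootActv_inv, hg0, neg_zero],
      by rw [sec_inv, hg0, sub_zero]⟩

/-- The group is transitive on the levels of the tree. -/
theorem exists_act_eq (hω : Function.Surjective ω) (hρ : Function.Surjective ρ)
    {u v : List (ZMod p)} (huv : u.length = v.length) :
    ∃ g ∈ spinalGroup ω ρ, g.act u = v := by
  induction u generalizing v with
  | nil => exact ⟨1, one_mem _, by simpa using (List.length_eq_zero_iff.1 huv.symm).symm⟩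
  | cons x u ih =>
    obtain ⟨y, w, rfl⟩ := List.exists_cons_of_length_eq_add_one huv.symm
    obtain ⟨h, hh, rfl⟩ := ih (v := w) (by simpa using huv)
    obtain ⟨g, hg, hg0, rfl⟩ := exists_sec_zero_eq hω hρ hh
    refine ⟨rootShift p y * g * rootShift p (-x),
      mul_mem (mul_mem (rootShift_mem ω ρ y) hg) (rootShift_mem ω ρ (-x)), ?_⟩
    simp [act_cons, hg0, sec_mul, rootActv_mul]

end Lifting

/-! ### A branching subgroup -/

section Branching

variable {p : ℕ} [Fact p.Prime]
variable {B : Type*} [AddCommGroup B] [Module (ZMod p) B]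

/-- The normal closure in `G_{ω,ρ}` of the commutators of `a` with the elements of `C`. -/
def branchSubgroup (ω : B →ₗ[ZMod p] ZMod p) (ρ : B →ₗ[ZMod p] B) (C : Submodule (ZMod p) B) :
    Subgroup (PAdicAut p) :=
  Subgroup.closure {g | ∃ h ∈ spinalGroup ω ρ, ∃ k, ∃ c ∈ C,
    g = h * ⁅rootShift p k, spinal ω ρ c⁆ * h⁻¹}

variable {ω : B →ₗ[ZMod p] ZMod p} {ρ : B →ₗ[ZMod p] B} {C : Submodule (ZMod p) B}

theorem branchSubgroup_le : branchSubgroup ω ρ C ≤ spinalGroup ω ρ := by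
  refine (Subgroup.closure_le _).2 ?_
  rintro _ ⟨h, hh, k, c, -, rfl⟩
  have h1 := rootShift_mem ω ρ k
  have h2 := spinal_mem ω ρ c
  exact mul_mem (mul_mem hh (mul_mem (mul_mem (mul_mem h1 h2) (inv_mem h1)) (inv_mem h2)))
    (inv_mem hh)

theorem conj_mem_branchSubgroup {g n : PAdicAut p} (hg : g ∈ spinalGroup ω ρ)
    (hn : n ∈ branchSubgroup ω ρ C) : g * n * g⁻¹ ∈ branchSubgroup ω ρ C := by
  induction hn using Subgroup.closure_induction with
  | mem n hn =>
    obtain ⟨h, hh, k, c, hc, rfl⟩ := hn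
    refine Subgroup.subset_closure ⟨g * h, mul_mem hg hh, k, c, hc, ?_⟩
    group
  | one => simp
  | mul m n _ _ hm hn => simpa [mul_assoc] using mul_mem hm hn
  | inv n _ hn => simpa [mul_assoc] using inv_mem hn

theorem commutator_mul_mem {c g h : PAdicAut p} (hg : g ∈ spinalGroup ω ρ)
    (h1 : ⁅c, g⁆ ∈ branchSubgroup ω ρ C) (h2 : ⁅c, h⁆ ∈ branchSubgroup ω ρ C) :
    ⁅c, g * h⁆ ∈ branchSubgroup ω ρ C := by
  have : ⁅c, g * h⁆ = ⁅c, g⁆ * (g * ⁅c, h⁆ * g⁻¹) := by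
    simp only [commutatorElement_def]
    group
  rw [this]
  exact mul_mem h1 (conj_mem_branchSubgroup hg h2)

theorem commutator_swap_mem {g h : PAdicAut p} (h1 : ⁅g, h⁆ ∈ branchSubgroup ω ρ C) :
    ⁅h, g⁆ ∈ branchSubgroup ω ρ C := by
  rw [← commutatorElement_inv]
  exact inv_mem h1

/-- The elements of `C` are central modulo the branching subgroup. -/
theorem commutator_spinal_mem {c : B} (hc : c ∈ C) {g : PAdicAut p}
    (hg : g ∈ spinalGroup ω ρ) : ⁅spinal ω ρ c, g⁆ ∈ branchSubgroup ω ρ C := by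
  induction hg using Subgroup.closure_induction with
  | mem g hg =>
    rcases hg with ⟨k, rfl⟩ | ⟨b, rfl⟩
    · refine commutator_swap_mem (Subgroup.subset_closure ⟨1, one_mem _, k, c, hc, ?_⟩)
      simp
    · have : ⁅spinal ω ρ c, spinal ω ρ b⁆ = 1 := by
        rw [commutatorElement_eq_one_iff_mul_comm, ← spinal_add, ← spinal_add, add_comm]
      rw [this]
      exact one_mem _
  | one => simp
  | mul g h hg _ h1 h2 => exact commutator_mul_mem hg h1 h2
  | inv g hg h1 =>
    have : ⁅spinal ω ρ c, g⁻¹⁆ = g⁻¹ * ⁅spinal ω ρ c, g⁆⁻¹ * (g⁻¹)⁻¹ := by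
      simp only [commutatorElement_def]
      group
    rw [this]
    exact conj_mem_branchSubgroup (inv_mem hg) (inv_mem h1)

/-- Modulo the branching subgroup, `B` commutes with its conjugate by `a`: up to elements of `C`,
which are central, the elements of `B` have trivial `ω`, and for these the two conjugates are
supported on disjoint subtrees. -/
theorem commutator_spinal_conj_mem (hC : ∀ b, ∃ c ∈ C, ω (b - c) = 0) (b b' : B) :
    ⁅spinal ω ρ b, rootShift p 1 * spinal ω ρ b' * (rootShift p 1)⁻¹⁆ ∈
      branchSubgroup ω ρ C := by
  obtain ⟨c, hc, hd⟩ := hC b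
  obtain ⟨c', hc', hd'⟩ := hC b'
  obtain ⟨d, rfl⟩ : ∃ d, b = c + d := ⟨b - c, by abel⟩
  obtain ⟨d', rfl⟩ : ∃ d', b' = c' + d' := ⟨b' - c', by abel⟩
  rw [add_sub_cancel_left] at hd hd'
  have ha := rootShift_mem ω ρ (1 : ZMod p)
  have ha' := inv_mem ha
  have hs := spinal_mem ω ρ
  have hconj : ∀ x : B, rootShift p 1 * spinal ω ρ x * (rootShift p 1)⁻¹ ∈ spinalGroup ω ρ :=
    fun x => mul_mem (mul_mem ha (hs x)) ha'
  rw [spinal_add ω ρ c d]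
  refine commutator_swap_mem (commutator_mul_mem (hs c)
    (commutator_swap_mem (commutator_spinal_mem hc (hconj _))) (commutator_swap_mem ?_))
  have e1 : rootShift p 1 * spinal ω ρ (c' + d') * (rootShift p 1)⁻¹ =
      (rootShift p 1 * spinal ω ρ c' * (rootShift p 1)⁻¹) *
        (rootShift p 1 * spinal ω ρ d' * (rootShift p 1)⁻¹) := by
    rw [spinal_add]
    group
  rw [e1]
  refine commutator_mul_mem (hconj c') ?_ ?_
  · have e2 : ⁅spinal ω ρ d, rootShift p 1 * spinal ω ρ c' * (rootShift p 1)⁻¹⁆ =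
        rootShift p 1 * ⁅(rootShift p 1)⁻¹ * spinal ω ρ d * rootShift p 1, spinal ω ρ c'⁆ *
          (rootShift p 1)⁻¹ := by
      simp only [commutatorElement_def]
      group
    rw [e2]
    exact conj_mem_branchSubgroup ha (commutator_swap_mem
      (commutator_spinal_mem hc' (mul_mem (mul_mem ha' (hs d)) ha)))
  · have e3 : ⁅spinal ω ρ d, rootShift p 1 * spinal ω ρ d' * (rootShift p 1)⁻¹⁆ = 1 := by
      refine ext_sec (by simp) fun x => ?_
      rw [sec_commutator (by simp) (by rw [rootActv_conj, rootActv_spinal]), sec_conj_rootShift,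
        sec_one]
      by_cases h0 : x = 0
      · simp [h0, hd]
      by_cases h1 : x - 1 = -1
      · exact absurd (by simpa using h1) h0
      by_cases h2 : x - 1 = 0
      · simp [h2, hd']
      · simp [sec_spinal_of_ne ω ρ d' h2 h1]
    rw [e3]
    exact one_mem _

/-- The branching subgroup contains its own copy on each subtree of level one. -/
theorem ofSec_mulSingle_mem (hω : Function.Surjective ω) (hρ : Function.Surjective ρ)
    (hC : ∀ b, ∃ c ∈ C, ω (b - c) = 0) (hC' : ∀ c ∈ C, ∃ b, ρ b = c ∧ (p = 2 → ω b = 0))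
    {n : PAdicAut p} (hn : n ∈ branchSubgroup ω ρ C) (x : ZMod p) :
    ofSec (Pi.mulSingle x n) ∈ branchSubgroup ω ρ C := by
  have hx : ofSec (Pi.mulSingle x n) =
      rootShift p x * ofSec (Pi.mulSingle 0 n) * (rootShift p x)⁻¹ := by
    refine ext_sec (by rw [rootActv_conj]; simp) fun y => ?_
    rw [sec_conj_rootShift, sec_ofSec, sec_ofSec]
    by_cases h : y = x
    · simp [h]
    · rw [Pi.mulSingle_eq_of_ne h, Pi.mulSingle_eq_of_ne (sub_ne_zero.2 h)]
  rw [hx]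
  clear hx
  refine conj_mem_branchSubgroup (rootShift_mem ω ρ x) ?_
  induction hn using Subgroup.closure_induction with
  | mem n hn =>
    obtain ⟨h, hh, k, c, hc, rfl⟩ := hn
    obtain ⟨b, rfl⟩ := hω k
    obtain ⟨b', rfl, hb'⟩ := hC' c hc
    obtain ⟨g, hg, hg0, rfl⟩ := exists_sec_zero_eq hω hρ hh
    have key : ofSec (Pi.mulSingle 0 (sec g 0 * ⁅rootShift p (ω b), spinal ω ρ (ρ b')⁆ *
        (sec g 0)⁻¹)) =
        g * ⁅spinal ω ρ b, rootShift p 1 * spinal ω ρ b' * (rootShift p 1)⁻¹⁆ * g⁻¹ := by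
      refine ext_sec (by rw [rootActv_conj]; simp) fun y => ?_
      rw [sec_mul, sec_mul, sec_inv, rootActv_inv, hg0, neg_zero, sub_zero, add_zero,
        rootActv_commutator, add_zero, sec_commutator (by simp)
        (by rw [rootActv_conj, rootActv_spinal]), sec_conj_rootShift, sec_ofSec]
      by_cases h0 : y = 0
      · subst h0
        simp
      rw [Pi.mulSingle_eq_of_ne h0]
      by_cases h1 : y = -1
      · have h2 : sec (spinal ω ρ b') (y - 1) = 1 := by
          by_cases h3 : y - 1 = 0
          · have hp : p = 2 := by
              have h4 : ((2 : ℕ) : ZMod p) = 0 := by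
                push_cast
                linear_combination h1 - h3
              exact ((Nat.prime_dvd_prime_iff_eq Fact.out Nat.prime_two).1
                ((ZMod.natCast_eq_zero_iff _ _).1 h4))
            rw [h3, sec_spinal_zero, hb' hp, rootShift_zero]
          · refine sec_spinal_of_ne ω ρ b' h3 fun h4 => h0 ?_
            linear_combination h4
        rw [h2]
        simp
      · rw [sec_spinal_of_ne ω ρ b h0 h1]
        simp
    rw [key]
    exact conj_mem_branchSubgroup hg (commutator_spinal_conj_mem hC b b')
  | one => simp
  | mul m n _ _ hm hn =>
    rw [Pi.mulSingle_mul, map_mul]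
    exact mul_mem hm hn
  | inv n _ hn =>
    rw [Pi.mulSingle_inv, map_inv]
    exact inv_mem hn

theorem ofSec_mem_branchSubgroup (hω : Function.Surjective ω) (hρ : Function.Surjective ρ)
    (hC : ∀ b, ∃ c ∈ C, ω (b - c) = 0) (hC' : ∀ c ∈ C, ∃ b, ρ b = c ∧ (p = 2 → ω b = 0))
    {s : ZMod p → PAdicAut p} (hs : ∀ x, s x ∈ branchSubgroup ω ρ C) :
    ofSec s ∈ branchSubgroup ω ρ C :=
  Subgroup.pi_mem_of_mulSingle_mem (H := (branchSubgroup ω ρ C).comap ofSec) s fun x =>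
    ofSec_mulSingle_mem hω hρ hC hC' (hs x) x

end Branching

/-! ### The activities realized on one level -/

section LevelActv

variable {p : ℕ}

/-- The activities of `g` on the vertices of level `k`. -/
noncomputable def levelActv (k : ℕ) (g : PAdicAut p) (u : Fin k → ZMod p) : ZMod p :=
  actv g (List.ofFn u)

theorem levelActv_mul {k : ℕ} (g : PAdicAut p) {h : PAdicAut p} (hh : h ∈ levelStab p k) :
    levelActv k (g * h) = levelActv k g + levelActv k h := by
  funext u
  simp only [levelActv, actv_mul, Pi.add_apply]
  rw [hh _ (List.length_ofFn)]

@[simp] theorem levelActv_one (k : ℕ) : levelActv k (1 : PAdicAut p) = 0 := by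
  funext u
  simp [levelActv]

theorem levelActv_inv {k : ℕ} {g : PAdicAut p} (hg : g ∈ levelStab p k) :
    levelActv k g⁻¹ = -levelActv k g := by
  have := levelActv_mul g (inv_mem hg)
  rw [mul_inv_cancel, levelActv_one] at this
  exact (neg_eq_of_add_eq_zero_right this.symm).symm

theorem levelActv_cons (k : ℕ) (g : PAdicAut p) (x : ZMod p) (u : Fin k → ZMod p) :
    levelActv (k + 1) g (Fin.cons x u) = levelActv k (sec g x) u := by
  simp [levelActv, actv_cons]

theorem levelActv_eq_zero_iff {k : ℕ} {g : PAdicAut p} (hg : g ∈ levelStab p k) :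
    levelActv k g = 0 ↔ g ∈ levelStab p (k + 1) := by
  rw [mem_levelStab_succ_iff_actv, and_iff_right hg]
  constructor
  · rintro h u rfl
    have := congrFun h u.get
    rwa [levelActv, List.ofFn_get] at this
  · exact fun h => funext fun u => h _ (List.length_ofFn)

/-- The functions on level `k` that are the activities of elements of `S` stabilizing level `k`. -/
noncomputable def levelFunctions (S : Subgroup (PAdicAut p)) (k : ℕ) :
    AddSubgroup ((Fin k → ZMod p) → ZMod p) where
  carrier := {φ | ∃ g ∈ S, g ∈ levelStab p k ∧ levelActv k g = φ}
  zero_mem' := ⟨1, one_mem _, one_mem _, levelActv_one k⟩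
  add_mem' := by
    rintro _ _ ⟨g, hg, hg', rfl⟩ ⟨h, hh, hh', rfl⟩
    exact ⟨g * h, mul_mem hg hh, mul_mem hg' hh', levelActv_mul g hh'⟩
  neg_mem' := by
    rintro _ ⟨g, hg, hg', rfl⟩
    exact ⟨g⁻¹, inv_mem hg, inv_mem hg', levelActv_inv hg'⟩

theorem mem_levelFunctions {S : Subgroup (PAdicAut p)} {k : ℕ}
    {φ : (Fin k → ZMod p) → ZMod p} :
    φ ∈ levelFunctions S k ↔ ∃ g ∈ S, g ∈ levelStab p k ∧ levelActv k g = φ := Iff.rfl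

theorem levelFunctions_mono {S T : Subgroup (PAdicAut p)} (h : S ≤ T) (k : ℕ) :
    levelFunctions S k ≤ levelFunctions T k := by
  rintro _ ⟨g, hg, hg', rfl⟩
  exact ⟨g, h hg, hg', rfl⟩

theorem levelFunctions_top (k : ℕ) : levelFunctions (⊤ : Subgroup (PAdicAut p)) k = ⊤ := by
  refine eq_top_iff.2 fun φ _ => ?_
  classical
  let g : PAdicAut p :=
    ofPortrait fun w => if h : w.length = k then φ fun i => w.get (i.cast h.symm) else 0
  refine ⟨g, trivial, mem_levelStab_iff_actv.2 fun u hu => ?_, funext fun u => ?_⟩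
  · rw [actv_ofPortrait, dif_neg hu.ne]
  · rw [levelActv, actv_ofPortrait, dif_pos List.length_ofFn]
    congr 1
    funext i
    simp

theorem slice_mem_levelFunctions [Fact p.Prime] {B : Type*} [AddCommGroup B] [Module (ZMod p) B]
    {ω : B →ₗ[ZMod p] ZMod p} {ρ : B →ₗ[ZMod p] B} {k : ℕ}
    {φ : (Fin (k + 1) → ZMod p) → ZMod p} (hφ : φ ∈ levelFunctions (spinalGroup ω ρ) (k + 1))
    (x : ZMod p) : (fun u => φ (Fin.cons x u)) ∈ levelFunctions (spinalGroup ω ρ) k := by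
  obtain ⟨g, hg, hg', rfl⟩ := hφ
  exact ⟨sec g x, sec_mem ω ρ hg x, sec_mem_levelStab hg' x,
    funext fun u => (levelActv_cons k g x u).symm⟩

theorem sum_cons {M : Type*} [AddCommMonoid M] [Fact p.Prime] (k : ℕ)
    (φ : (Fin (k + 1) → ZMod p) → M) :
    ∑ u, φ u = ∑ x, ∑ u : Fin k → ZMod p, φ (Fin.cons x u) := by
  rw [← Fintype.sum_prod_type', ← (Fin.consEquiv fun _ : Fin (k + 1) => ZMod p).sum_comp]
  rfl

theorem sum_levelActv [Fact p.Prime] (k : ℕ) (g : PAdicAut p) :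
    ∑ u, levelActv k g u = sigma k g := by
  induction k generalizing g with
  | zero => simp [levelActv, sigma, rootActv]
  | succ k ih => simp only [sum_cons, levelActv_cons, ih, sigma]

end LevelActv

/-! ### The functions realized by the branching subgroup -/

section Lower

variable {p : ℕ} [Fact p.Prime]
variable {B : Type*} [AddCommGroup B] [Module (ZMod p) B]
variable {ω : B →ₗ[ZMod p] ZMod p} {ρ : B →ₗ[ZMod p] B} {C : Submodule (ZMod p) B}

theorem mem_levelFunctions_succ (hω : Function.Surjective ω) (hρ : Function.Surjective ρ)
    (hC : ∀ b, ∃ c ∈ C, ω (b - c) = 0) (hC' : ∀ c ∈ C, ∃ b, ρ b = c ∧ (p = 2 → ω b = 0))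
    {k : ℕ} {φ : (Fin (k + 1) → ZMod p) → ZMod p}
    (hφ : ∀ x, (fun u => φ (Fin.cons x u)) ∈ levelFunctions (branchSubgroup ω ρ C) k) :
    φ ∈ levelFunctions (branchSubgroup ω ρ C) (k + 1) := by
  choose s hs hs' hs'' using hφ
  refine ⟨ofSec s, ofSec_mem_branchSubgroup hω hρ hC hC' hs, ofSec_mem_levelStab hs',
    funext fun u => ?_⟩
  rw [← Fin.cons_self_tail u, levelActv_cons, sec_ofSec, hs'']

/-- An element `b` that is invisible to the first `j` functionals `ω ρ^i` stabilizes level `j + 1`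
and is active there only at the vertex `(p-1)^j 0`. -/
theorem spinal_mem_levelStab {j : ℕ} {b : B} (hb : ∀ i < j, ω ((ρ ^ i) b) = 0) :
    spinal ω ρ b ∈ levelStab p (j + 1) ∧ ∀ u : List (ZMod p), u.length = j + 1 →
      actv (spinal ω ρ b) u =
        if u = List.replicate j (-1) ++ [0] then ω ((ρ ^ j) b) else 0 := by
  induction j generalizing b with
  | zero =>
    refine ⟨mem_levelStab_succ_iff_sec.2 ⟨by simp, by simp [levelStab_zero]⟩, fun u hu => ?_⟩
    obtain ⟨x, rfl⟩ := List.length_eq_one_iff.1 hu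
    rw [actv_cons]
    change rootActv _ = _
    by_cases h0 : x = 0
    · simp [h0]
    by_cases h1 : x = -1
    · simp [h1]
    · simp [sec_spinal_of_ne ω ρ b h0 h1, h0]
  | succ j ih =>
    have hω : ω b = 0 := hb 0 (by omega)
    obtain ⟨h1, h2⟩ := ih (b := ρ b) fun i hi => hb (i + 1) (by omega)
    constructor
    · refine mem_levelStab_succ_iff_sec.2 ⟨by simp, fun x => ?_⟩
      by_cases h0 : x = 0
      · rw [h0, sec_spinal_zero, hω, rootShift_zero]
        exact one_mem _
      by_cases h3 : x = -1
      · rwa [h3, sec_spinal_neg_one]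
      · rw [sec_spinal_of_ne ω ρ b h0 h3]
        exact one_mem _
    · intro u hu
      obtain ⟨x, w, rfl⟩ := List.exists_cons_of_length_eq_add_one hu
      rw [actv_cons]
      by_cases h0 : x = 0
      · simp [h0, hω, List.replicate_succ]
      by_cases h3 : x = -1
      · rw [h3, sec_spinal_neg_one, h2 w (by simpa using hu)]
        simp only [List.replicate_succ, List.cons_append, List.cons.injEq, true_and]
        rfl
      · rw [sec_spinal_of_ne ω ρ b h0 h3, actv_one]
        simp [List.replicate_succ, h3]

/-- If `C` contains an element active at a single vertex of level `j + 1`, then all functions of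
sum zero on this level are realized: the commutators of its conjugates give the differences of
two point masses. -/
theorem mem_levelFunctions_of_sum_eq_zero (hω : Function.Surjective ω)
    (hρ : Function.Surjective ρ) {j : ℕ} {c : B} (hc : c ∈ C)
    (hcj : ∀ i < j, ω ((ρ ^ i) c) = 0) (hcj' : ω ((ρ ^ j) c) = 1)
    {φ : (Fin (j + 1) → ZMod p) → ZMod p} (hφ : ∑ u, φ u = 0) :
    φ ∈ levelFunctions (branchSubgroup ω ρ C) (j + 1) := by
  obtain ⟨h1, h2⟩ := spinal_mem_levelStab hcj
  have hsingle : ∀ v : Fin (j + 1) → ZMod p, ∃ h ∈ spinalGroup ω ρ,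
      levelActv (j + 1) (h * spinal ω ρ c * h⁻¹) = Pi.single v 1 := by
    intro v
    obtain ⟨h, hh, hv⟩ := exists_act_eq hω hρ (u := List.replicate j (-1) ++ [0])
      (v := List.ofFn v) (by simp)
    refine ⟨h, hh, funext fun u => ?_⟩
    rw [levelActv, actv_conj h1 h List.length_ofFn, h2 _ (by simp [length_act]), hcj',
      Pi.single_apply]
    refine if_congr ?_ rfl rfl
    rw [← List.ofFn_inj (f := u), ← hv]
    constructor
    · intro h3
      rw [← h3, ← act_mul, mul_inv_cancel, act_one]
    · intro h3
      rw [h3, ← act_mul, inv_mul_cancel, act_one]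
  have hdiff : ∀ v w : Fin (j + 1) → ZMod p, (Pi.single v 1 - Pi.single w 1 : _ → ZMod p) ∈
      levelFunctions (branchSubgroup ω ρ C) (j + 1) := by
    intro v w
    obtain ⟨g, hg, hgv⟩ := hsingle v
    obtain ⟨h, hh, hhw⟩ := hsingle w
    have hgs := (levelStab_normal p (j + 1)).conj_mem _ h1 g
    have hhs := (levelStab_normal p (j + 1)).conj_mem _ h1 h
    refine ⟨(g * spinal ω ρ c * g⁻¹) * (h * spinal ω ρ c * h⁻¹)⁻¹, ?_,
      mul_mem hgs (inv_mem hhs), ?_⟩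
    · have e : (g * spinal ω ρ c * g⁻¹) * (h * spinal ω ρ c * h⁻¹)⁻¹ =
          h * ⁅h⁻¹ * g, spinal ω ρ c⁆ * h⁻¹ := by
        simp only [commutatorElement_def]
        group
      rw [e]
      exact conj_mem_branchSubgroup hh
        (commutator_swap_mem (commutator_spinal_mem hc (mul_mem (inv_mem hh) hg)))
    · rw [levelActv_mul _ (inv_mem hhs), levelActv_inv hhs, hgv, hhw, sub_eq_add_neg]
  have hsum : φ = ∑ v, (φ v).val • (Pi.single v 1 - Pi.single 0 1 : _ → ZMod p) := by
    have h3 : ∀ v, (φ v).val • (Pi.single v 1 - Pi.single 0 1 : _ → ZMod p) =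
        Pi.single v (φ v) - φ v • Pi.single 0 1 := by
      intro v
      rw [← Nat.cast_smul_eq_nsmul (ZMod p), ZMod.natCast_zmod_val, smul_sub]
      congr 1
      rw [← Pi.single_smul]
      simp
    rw [Finset.sum_congr rfl fun v _ => h3 v, Finset.sum_sub_distrib, ← Finset.sum_smul, hφ,
      zero_smul, sub_zero, Finset.univ_sum_single]
  rw [hsum]
  exact sum_mem fun v _ => nsmul_mem (hdiff v 0) _

end Lower

/-! ### Exactly which functions are realized on level `d + 2` -/

section Constraints

variable {p : ℕ} [Fact p.Prime]
variable {B : Type*} [AddCommGroup B] [Module (ZMod p) B]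

/-- What the argument uses of the companion matrix `ρ` of a polynomial of degree `d + 1` with nonzero
constant term: `ρ` is surjective, the functionals `ω ρ^i`, `i ≤ d`, are independent, and `ω ρ⁻¹` is
their combination with coefficients `c_i`, where `c_d ≠ 0`. -/
structure IsCyclicPair (ω : B →ₗ[ZMod p] ZMod p) (ρ : B →ₗ[ZMod p] B) (d : ℕ) (c : ℕ → ZMod p) :
    Prop where
  surjective : Function.Surjective ρ
  interpolate : ∀ t : ℕ → ZMod p, ∃ b, ∀ i ≤ d, ω ((ρ ^ i) b) = t i
  relation : ∀ b, ∑ j ∈ Finset.range (d + 1), c j * ω ((ρ ^ j) (ρ b)) = ω b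
  leading_ne : c d ≠ 0

theorem IsCyclicPair.surjective_functional {ω : B →ₗ[ZMod p] ZMod p} {ρ : B →ₗ[ZMod p] B}
    {d : ℕ} {c : ℕ → ZMod p} (h : IsCyclicPair ω ρ d c) : Function.Surjective ω := fun k => by
  obtain ⟨b, hb⟩ := h.interpolate fun _ => k
  exact ⟨b, by simpa using hb 0 (Nat.zero_le d)⟩

/-- The kernel of a surjective homomorphism from a finite group has the expected size. -/
theorem card_ker_mul {M N : Type*} [AddGroup M] [AddGroup N] {L : M →+ N}
    (hL : Function.Surjective L) : Nat.card L.ker * Nat.card N = Nat.card M := by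
  rw [← L.ker.card_mul_index, AddSubgroup.index_ker, AddMonoidHom.range_eq_top.2 hL,
    AddSubgroup.card_top]

omit [Fact p.Prime] in
theorem card_level (k : ℕ) : Nat.card (Fin k → ZMod p) = p ^ k := by
  rw [Nat.card_fun, Nat.card_zmod, Nat.card_fin]

theorem card_level_functions (k : ℕ) : Nat.card ((Fin k → ZMod p) → ZMod p) = p ^ p ^ k := by
  rw [Nat.card_fun, Nat.card_zmod, card_level]

/-- The sums of a function over the subtrees of the letters. -/
def letterSums (k : ℕ) : ((Fin (k + 1) → ZMod p) → ZMod p) →+ (ZMod p → ZMod p) where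
  toFun φ x := ∑ u, φ (Fin.cons x u)
  map_zero' := by funext x; simp
  map_add' φ ψ := by funext x; simp [Finset.sum_add_distrib]

theorem letterSums_surjective (k : ℕ) : Function.Surjective (letterSums (p := p) k) := by
  intro t
  refine ⟨fun u => if Fin.tail u = 0 then t (u 0) else 0, funext fun x => ?_⟩
  simp [letterSums]

/-- For odd `p`, the functions realized by the group on level `d + 2` are those whose sum over
the subtree of each letter vanishes. -/
theorem levelFunctions_constraint_odd {ω : B →ₗ[ZMod p] ZMod p} {ρ : B →ₗ[ZMod p] B} {d : ℕ}
    {c : ℕ → ZMod p} (h : IsCyclicPair ω ρ d c) (hp : p ≠ 2) :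
    levelFunctions (spinalGroup ω ρ) (d + 2) ≤ (letterSums (p := p) (d + 1)).ker ∧
    (letterSums (p := p) (d + 1)).ker ≤ levelFunctions (branchSubgroup ω ρ ⊤) (d + 2) := by
  constructor
  · rintro _ ⟨g, hg, hg', rfl⟩
    refine funext fun x => ?_
    change ∑ u, levelActv (d + 2) g (Fin.cons x u) = 0
    simp only [levelActv_cons, sum_levelActv]
    exact sigma_sec_eq_zero ω ρ h.relation h.leading_ne hg hg' x
  · intro φ hφ
    refine mem_levelFunctions_succ (C := ⊤) h.surjective_functional h.surjective
      (fun b => ⟨b, trivial, by simp⟩) (fun b _ => ?_) fun x => ?_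
    · obtain ⟨b', rfl⟩ := h.surjective b
      exact ⟨b', rfl, fun h => absurd h hp⟩
    · obtain ⟨b, hb⟩ := h.interpolate fun i => if i = d then 1 else 0
      refine mem_levelFunctions_of_sum_eq_zero (C := ⊤) h.surjective_functional h.surjective
        (c := b) trivial (fun i hi => ?_) ?_ (congrFun hφ x)
      · rw [hb i hi.le, if_neg hi.ne]
      · rw [hb d le_rfl, if_pos rfl]

end Constraints

section ConstraintsTwo

variable {B : Type*} [AddCommGroup B] [Module (ZMod 2) B]

/-- The differences between the sum of a function over the subtree of the word `00` and its sums
over the other subtrees of level two. -/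
def quarterSums (k : ℕ) : ((Fin (k + 2) → ZMod 2) → ZMod 2) →+
    ({z : ZMod 2 × ZMod 2 // z ≠ 0} → ZMod 2) where
  toFun φ z := ∑ u : Fin k → ZMod 2, φ (Fin.cons z.1.1 (Fin.cons z.1.2 u)) -
    ∑ u : Fin k → ZMod 2, φ (Fin.cons 0 (Fin.cons 0 u))
  map_zero' := by funext x; simp
  map_add' φ ψ := by
    funext x
    simp only [Pi.add_apply, Finset.sum_add_distrib]
    ring

theorem quarterSums_surjective (k : ℕ) : Function.Surjective (quarterSums k) := by
  intro t
  refine ⟨fun u => if Fin.tail (Fin.tail u) = 0 then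
    (if h : (u 0, Fin.tail u 0) ≠ 0 then t ⟨_, h⟩ else 0) else 0, funext fun z => ?_⟩
  have hz : z.1.1 = 0 → z.1.2 ≠ 0 := fun h1 h2 => z.2 (Prod.ext h1 h2)
  simp only [quarterSums, AddMonoidHom.coe_mk, ZeroHom.coe_mk, Fin.tail_cons, Fin.cons_zero,
    Finset.sum_ite_eq', Finset.mem_univ, if_true, Prod.mk.eta, ne_eq]
  rw [dif_pos z.2, dif_neg (by simp), sub_zero]

theorem mem_ker_quarterSums {k : ℕ} {φ : (Fin (k + 2) → ZMod 2) → ZMod 2} :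
    φ ∈ (quarterSums k).ker ↔ ∀ x y, ∑ u : Fin k → ZMod 2, φ (Fin.cons x (Fin.cons y u)) =
      ∑ u : Fin k → ZMod 2, φ (Fin.cons 0 (Fin.cons 0 u)) := by
  constructor
  · intro h x y
    by_cases hz : ((x, y) : ZMod 2 × ZMod 2) = 0
    · obtain ⟨rfl, rfl⟩ := Prod.mk.inj hz
      rfl
    · exact sub_eq_zero.1 (congrFun h ⟨(x, y), hz⟩)
  · exact fun h => funext fun z => sub_eq_zero.2 (h _ _)

/-- For `p = 2` the subspace `ρ(ker ω)` is large enough for `B` to commute with `a B a⁻¹` modulo the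
branching subgroup, and small enough for the latter to be branching. -/
theorem decomposition_map_ker {ω : B →ₗ[ZMod 2] ZMod 2} {ρ : B →ₗ[ZMod 2] B} {d : ℕ}
    {c : ℕ → ZMod 2} (h : IsCyclicPair ω ρ d c) (hd : 1 ≤ d) :
    (∀ b, ∃ e ∈ (LinearMap.ker ω).map ρ, ω (b - e) = 0) ∧
    (∀ e ∈ (LinearMap.ker ω).map ρ, ∃ b, ρ b = e ∧ (2 = 2 → ω b = 0)) := by
  constructor
  · intro b
    obtain ⟨b, rfl⟩ := h.surjective b
    obtain ⟨e, he⟩ := h.interpolate fun i => if i = 0 then 1 else 0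
    have he0 : ω e = 1 := by simpa using he 0 (Nat.zero_le d)
    have he1 : ω (ρ e) = 0 := by simpa using he 1 hd
    refine ⟨ρ (b - ω b • e), ⟨_, ?_, rfl⟩, ?_⟩
    · simp [he0]
    · simp [he1]
  · rintro _ ⟨b, hb, rfl⟩
    exact ⟨b, rfl, fun _ => hb⟩

/-- For `p = 2`, the functions realized by the group on level `d + 2` are those whose sums over
the four subtrees of level two agree. -/
theorem levelFunctions_constraint_two {ω : B →ₗ[ZMod 2] ZMod 2} {ρ : B →ₗ[ZMod 2] B} {d : ℕ}
    {c : ℕ → ZMod 2} (h : IsCyclicPair ω ρ d c) (hd : 1 ≤ d) :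
    levelFunctions (spinalGroup ω ρ) (d + 2) ≤ (quarterSums d).ker ∧
    (quarterSums d).ker ≤
      levelFunctions (branchSubgroup ω ρ ((LinearMap.ker ω).map ρ)) (d + 2) := by
  have hω := h.surjective_functional
  have hρ := h.surjective
  obtain ⟨hC, hC'⟩ := decomposition_map_ker h hd
  constructor
  · rintro _ ⟨g, hg, hg', rfl⟩
    refine mem_ker_quarterSums.2 fun x y => ?_
    simp only [levelActv_cons, sum_levelActv]
    exact sigma_sec_sec_eq ω ρ hd h.relation h.leading_ne hg hg' x y
  · have hzero : ∀ φ : (Fin (d + 2) → ZMod 2) → ZMod 2,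
        (∀ x y, ∑ u : Fin d → ZMod 2, φ (Fin.cons x (Fin.cons y u)) = 0) →
        φ ∈ levelFunctions (branchSubgroup ω ρ ((LinearMap.ker ω).map ρ)) (d + 2) := by
      intro φ hφ
      refine mem_levelFunctions_succ hω hρ hC hC' fun x =>
        mem_levelFunctions_succ hω hρ hC hC' fun y => ?_
      obtain ⟨j, rfl⟩ := Nat.exists_eq_add_of_le' hd
      -- The last value is chosen so that `ω` vanishes on the preimage of the element under `ρ`.
      obtain ⟨e, he⟩ := h.interpolate fun i =>
        if i < j then 0 else if i = j then 1 else -(c j) / c (j + 1)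
      obtain ⟨b, rfl⟩ := hρ e
      have hb : ω b = 0 := by
        rw [← h.relation b, Finset.sum_range_succ, Finset.sum_range_succ, Finset.sum_eq_zero,
          he j (by omega), he (j + 1) le_rfl]
        · have := h.leading_ne
          simp only [lt_irrefl, if_false, if_true, Nat.succ_ne_self,
            show ¬ j + 1 < j by omega]
          field_simp
          ring
        · intro i hi
          have hi' := Finset.mem_range.1 hi
          rw [he i (by omega), if_pos hi', mul_zero]
      refine mem_levelFunctions_of_sum_eq_zero hω hρ (c := ρ b)
        (Submodule.mem_map_of_mem hb) (fun i hi => ?_) ?_ (hφ x y)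
      · rw [he i (by omega), if_pos hi]
      · rw [he j (by omega), if_neg (lt_irrefl j), if_pos rfl]
    obtain ⟨e, he⟩ := h.interpolate fun i => if i = d then 1 else 0
    obtain ⟨b, rfl⟩ := hρ e
    have h01 : ∀ k : ZMod 2, k = 0 ∨ k = 1 := by decide
    have hωb : ω b = 1 := by
      have := h.leading_ne
      rw [← h.relation b, Finset.sum_range_succ, Finset.sum_eq_zero, he d le_rfl]
      · simpa using (h01 (c d)).resolve_left this
      · intro i hi
        have hi' := Finset.mem_range.1 hi
        rw [he i hi'.le, if_neg hi'.ne, mul_zero]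
    have hstab : spinal ω ρ (ρ b) ∈ levelStab 2 (d + 1) :=
      (spinal_mem_levelStab (j := d) fun i hi => by rw [he i hi.le, if_neg hi.ne]).1
    have hsig : ∀ y, sigma d (sec (spinal ω ρ (ρ b)) y) = y := by
      obtain ⟨j, rfl⟩ := Nat.exists_eq_add_of_le' hd
      intro y
      rcases h01 y with rfl | rfl
      · rw [sec_spinal_zero, sigma_rootShift]
      · have h1 : sec (spinal ω ρ (ρ b)) 1 = spinal ω ρ (ρ (ρ b)) := sec_spinal_neg_one ω ρ _
        rw [h1, sigma_succ_spinal]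
        have := he (j + 1) le_rfl
        rwa [if_pos rfl, pow_succ] at this
    -- The commutator that acts on the two subtrees of level one as `⁅a, ρ b⁆` and `⁅ρ b, a⁆`.
    have hmem := commutator_spinal_conj_mem (ρ := ρ) hC b b
    set n := ⁅spinal ω ρ b, rootShift 2 1 * spinal ω ρ b * (rootShift 2 1)⁻¹⁆ with hn
    set w := ⁅rootShift 2 1, spinal ω ρ (ρ b)⁆ with hw
    have hn0 : sec n 0 = w := by
      have h1 : sec (spinal ω ρ b) (0 - 1) = spinal ω ρ (ρ b) := sec_spinal_neg_one ω ρ b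
      rw [hn, sec_commutator (by simp) (by rw [rootActv_conj, rootActv_spinal]),
        sec_conj_rootShift, h1, sec_spinal_zero, hωb]
    have hn1 : sec n 1 = w⁻¹ := by
      have h1 : sec (spinal ω ρ b) 1 = spinal ω ρ (ρ b) := sec_spinal_neg_one ω ρ b
      rw [hn, sec_commutator (by simp) (by rw [rootActv_conj, rootActv_spinal]),
        sec_conj_rootShift, h1, sub_self, sec_spinal_zero, hωb, hw, commutatorElement_inv]
    have hwstab : w ∈ levelStab 2 (d + 1) :=
      mul_mem ((levelStab_normal 2 (d + 1)).conj_mem _ hstab _) (inv_mem hstab)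
    have hnstab : n ∈ levelStab 2 (d + 2) := by
      refine mem_levelStab_succ_iff_sec.2 ⟨rootActv_commutator _ _, fun x => ?_⟩
      rcases h01 x with rfl | rfl
      · rwa [hn0]
      · rw [hn1]
        exact inv_mem hwstab
    have hwsig : ∀ y, sigma d (sec w y) = 1 := by
      intro y
      have h1 : sec w y = sec (spinal ω ρ (ρ b)) (y - 1) * (sec (spinal ω ρ (ρ b)) y)⁻¹ := by
        rw [hw, commutatorElement_def, sec_mul, sec_conj_rootShift, sec_inv, rootActv_inv,
          rootActv_spinal, neg_zero, add_zero, sub_zero]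
      rw [h1, sigma_mul, sigma_inv, hsig, hsig]
      clear * -
      decide +revert
    have hnsig : ∀ x y, sigma d (sec (sec n x) y) = 1 := by
      intro x y
      rcases h01 x with rfl | rfl
      · rw [hn0, hwsig]
      · rw [hn1, sec_inv, sigma_inv, hwsig]
        rfl
    intro φ hφ
    rw [mem_ker_quarterSums] at hφ
    rcases h01 (∑ u : Fin d → ZMod 2, φ (Fin.cons 0 (Fin.cons 0 u))) with h0 | h0
    · exact hzero φ fun x y => by rw [hφ, h0]
    · have h2 := add_mem (hzero (φ - levelActv (d + 2) n) fun x y => by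
        simp only [Pi.sub_apply, Finset.sum_sub_distrib, levelActv_cons, sum_levelActv, hnsig]
        rw [hφ, h0, sub_self]) (mem_levelFunctions.2 ⟨n, hmem, hnstab, rfl⟩)
      simpa using h2

end ConstraintsTwo

/-! ### Indices of the level stabilizers -/

theorem card_nonzero_pairs : Nat.card {z : ZMod 2 × ZMod 2 // z ≠ 0} = 3 := by
  rw [Nat.card_eq_fintype_card]
  decide

section Counting

variable {p : ℕ} [Fact p.Prime]

theorem relIndex_succ (S : Subgroup (PAdicAut p)) (k : ℕ) :
    (levelStab p (k + 1)).relIndex S =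
      (levelStab p k).relIndex S * Nat.card (levelFunctions S k) := by
  have h1 : levelStab p (k + 1) ⊓ S ≤ levelStab p k ⊓ S :=
    inf_le_inf_right S (levelStab_succ_le p k)
  let f : ↥(levelStab p k ⊓ S) →* Multiplicative ((Fin k → ZMod p) → ZMod p) :=
    { toFun := fun g => Multiplicative.ofAdd (levelActv k g.1)
      map_one' := by simp
      map_mul' := fun g h => by
        rw [Subgroup.coe_mul, levelActv_mul _ h.2.1, ofAdd_add] }
  have hker : f.ker = (levelStab p (k + 1) ⊓ S).subgroupOf (levelStab p k ⊓ S) := by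
    ext g
    have hgS : (g : PAdicAut p) ∈ S := g.2.2
    rw [MonoidHom.mem_ker, Subgroup.mem_subgroupOf, Subgroup.mem_inf, and_iff_left hgS,
      ← levelActv_eq_zero_iff g.2.1]
    exact ofAdd_eq_one
  have hrange : Nat.card f.range = Nat.card (levelFunctions S k) := by
    refine Nat.card_congr (Equiv.subtypeEquiv Multiplicative.toAdd fun φ => ?_)
    constructor
    · rintro ⟨g, rfl⟩
      exact ⟨g.1, g.2.2, g.2.1, rfl⟩
    · rintro ⟨g, hg, hg', h⟩
      exact ⟨⟨g, hg', hg⟩, h⟩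
  have h2 := Subgroup.relIndex_mul_relIndex _ _ _ h1 inf_le_right
  rw [Subgroup.inf_relIndex_right, Subgroup.inf_relIndex_right, Subgroup.relIndex, ← hker,
    Subgroup.index_ker, hrange] at h2
  rw [← h2, mul_comm]

theorem levelIndex_succ (k : ℕ) : levelIndex p (k + 1) = levelIndex p k * p ^ p ^ k := by
  have h := relIndex_succ (⊤ : Subgroup (PAdicAut p)) k
  rwa [Subgroup.relIndex_top_right, Subgroup.relIndex_top_right, levelFunctions_top,
    AddSubgroup.card_top, card_level_functions] at h

/-- An element of the closure agrees with an element of the subgroup on every given level. -/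
theorem levelFunctions_topologicalClosure (S : Subgroup (PAdicAut p)) (k : ℕ) :
    levelFunctions S.topologicalClosure k = levelFunctions S k := by
  refine le_antisymm ?_ (levelFunctions_mono S.le_topologicalClosure k)
  rintro _ ⟨g, hg, hg', rfl⟩
  have hpos : (0 : ℝ) < 1 / (levelIndex p (k + 1) : ℝ) := by
    have := levelIndex_pos p (k + 1)
    positivity
  obtain ⟨h, hh, hd⟩ := Metric.mem_closure_iff.1 hg _ hpos
  have hmem : g⁻¹ * h ∈ levelStab p (k + 1) := sInf_distSet_lt hd
  have hmem' := levelStab_succ_le p k hmem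
  have hgh : g * (g⁻¹ * h) = h := mul_inv_cancel_left g h
  refine ⟨h, hh, hgh ▸ mul_mem hg' hmem', ?_⟩
  rw [← hgh, levelActv_mul g hmem', (levelActv_eq_zero_iff hmem').2 hmem, add_zero]

variable {B : Type*} [AddCommGroup B] [Module (ZMod p) B]
variable {ω : B →ₗ[ZMod p] ZMod p} {ρ : B →ₗ[ZMod p] B}

theorem card_levelFunctions_succ_le (k : ℕ) :
    Nat.card (levelFunctions (spinalGroup ω ρ) (k + 1)) ≤
      Nat.card (levelFunctions (spinalGroup ω ρ) k) ^ p := by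
  have h := Nat.card_fun (α := ZMod p) (β := levelFunctions (spinalGroup ω ρ) k)
  rw [Nat.card_zmod] at h
  rw [← h]
  refine Nat.card_le_card_of_injective
    (fun φ x => ⟨fun u => φ.1 (Fin.cons x u), slice_mem_levelFunctions φ.2 x⟩) ?_
  intro φ ψ hφψ
  refine Subtype.ext (funext fun u => ?_)
  have := congrFun (congrArg Subtype.val (congrFun hφψ (u 0))) (Fin.tail u)
  simpa using this

theorem pow_card_levelFunctions_le {C : Submodule (ZMod p) B} (hω : Function.Surjective ω)
    (hρ : Function.Surjective ρ) (hC : ∀ b, ∃ c ∈ C, ω (b - c) = 0)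
    (hC' : ∀ c ∈ C, ∃ b, ρ b = c ∧ (p = 2 → ω b = 0)) (k : ℕ) :
    Nat.card (levelFunctions (branchSubgroup ω ρ C) k) ^ p ≤
      Nat.card (levelFunctions (branchSubgroup ω ρ C) (k + 1)) := by
  have h := Nat.card_fun (α := ZMod p) (β := levelFunctions (branchSubgroup ω ρ C) k)
  rw [Nat.card_zmod] at h
  rw [← h]
  refine Nat.card_le_card_of_injective
    (fun s => ⟨fun u => (s (u 0)).1 (Fin.tail u),
      mem_levelFunctions_succ hω hρ hC hC' fun x => by simp⟩) ?_
  intro s t hst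
  refine funext fun x => Subtype.ext (funext fun u => ?_)
  have := congrFun (congrArg Subtype.val hst) (Fin.cons x u)
  simpa using this

/-- The codimension of the space of realized functions in each block of `p ^ (d + 2)` vertices. -/
def codimension (p : ℕ) : ℕ := if p = 2 then 3 else p

/-- From level `d + 2` on, the number of realized functions is known exactly. -/
theorem card_levelFunctions {d : ℕ} {c : ℕ → ZMod p} (h : IsCyclicPair ω ρ d c) (hd : 1 ≤ d)
    (j : ℕ) :
    Nat.card (levelFunctions (spinalGroup ω ρ) (d + 2 + j)) * p ^ (codimension p * p ^ j) =
      p ^ p ^ (d + 2 + j) := by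
  obtain ⟨C, Y, hC, hC', hY, hle, hge⟩ : ∃ (C : Submodule (ZMod p) B)
      (Y : AddSubgroup ((Fin (d + 2) → ZMod p) → ZMod p)),
      (∀ b, ∃ c ∈ C, ω (b - c) = 0) ∧ (∀ c ∈ C, ∃ b, ρ b = c ∧ (p = 2 → ω b = 0)) ∧
      Nat.card Y * p ^ codimension p = p ^ p ^ (d + 2) ∧
      levelFunctions (spinalGroup ω ρ) (d + 2) ≤ Y ∧
      Y ≤ levelFunctions (branchSubgroup ω ρ C) (d + 2) := by
    by_cases hp : p = 2
    · subst hp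
      obtain ⟨hC, hC'⟩ := decomposition_map_ker h hd
      refine ⟨_, _, hC, hC', ?_, levelFunctions_constraint_two h hd⟩
      have h1 := card_ker_mul (quarterSums_surjective d)
      rwa [card_level_functions, Nat.card_fun, Nat.card_zmod, card_nonzero_pairs] at h1
    · refine ⟨⊤, _, fun b => ⟨b, Submodule.mem_top, by simp⟩, fun b _ => ?_, ?_,
        levelFunctions_constraint_odd h hp⟩
      · obtain ⟨b', rfl⟩ := h.surjective b
        exact ⟨b', rfl, fun h => absurd h hp⟩
      · have h1 := card_ker_mul (letterSums_surjective (p := p) (d + 1))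
        rwa [card_level_functions, Nat.card_fun, Nat.card_zmod,
          show p ^ p = p ^ codimension p by rw [codimension, if_neg hp]] at h1
  have hYj : Nat.card (levelFunctions (spinalGroup ω ρ) (d + 2 + j)) = Nat.card Y ^ p ^ j := by
    refine le_antisymm ?_ ?_
    · induction j with
      | zero => simpa using Nat.card_mono (Set.toFinite _) hle
      | succ j ih =>
        refine (card_levelFunctions_succ_le (d + 2 + j)).trans ?_
        rw [pow_succ, pow_mul]
        exact Nat.pow_le_pow_left ih p
    · have h1 : Nat.card Y ^ p ^ j ≤
          Nat.card (levelFunctions (branchSubgroup ω ρ C) (d + 2 + j)) := by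
        induction j with
        | zero => simpa using Nat.card_mono (Set.toFinite _) hge
        | succ j ih =>
          refine le_trans ?_ (pow_card_levelFunctions_le h.surjective_functional h.surjective
            hC hC' (d + 2 + j))
          rw [pow_succ, pow_mul]
          exact Nat.pow_le_pow_left ih p
      exact h1.trans (Nat.card_mono (Set.toFinite _) (levelFunctions_mono branchSubgroup_le _))
  rw [hYj, pow_mul, ← mul_pow, hY, ← pow_mul, ← pow_add]

/-- The Hausdorff dimension of the closure of the group. -/
noncomputable def dimension (p d : ℕ) : ℝ := 1 - codimension p / (p : ℝ) ^ (d + 2)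

theorem codimension_lt (p d : ℕ) [Fact p.Prime] (hd : 1 ≤ d) :
    (codimension p : ℝ) < (p : ℝ) ^ (d + 2) := by
  have hp := (Fact.out : p.Prime).two_le
  have h1 : p ^ 2 < p ^ (d + 2) := Nat.pow_lt_pow_right hp (by omega)
  have h2 : codimension p ≤ p ^ 2 := by
    unfold codimension
    split_ifs with h
    · subst h; norm_num
    · nlinarith
  exact_mod_cast h2.trans_lt h1

theorem dimension_pos {d : ℕ} (hd : 1 ≤ d) : 0 < dimension p d := by
  have hp : (0 : ℝ) < p := by exact_mod_cast (Fact.out : p.Prime).pos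
  have := (div_lt_one (pow_pos hp (d + 2))).2 (codimension_lt p d hd)
  unfold dimension
  linarith

theorem card_levelFunctions_eq_rpow {d : ℕ} {c : ℕ → ZMod p} (h : IsCyclicPair ω ρ d c)
    (hd : 1 ≤ d) (j : ℕ) :
    (Nat.card (levelFunctions (spinalGroup ω ρ) (d + 2 + j)) : ℝ) =
      ((p ^ p ^ (d + 2 + j) : ℕ) : ℝ) ^ dimension p d := by
  have hp : (0 : ℝ) < p := by exact_mod_cast (Fact.out : p.Prime).pos
  have h1 : (Nat.card (levelFunctions (spinalGroup ω ρ) (d + 2 + j)) : ℝ) *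
      (p : ℝ) ^ (codimension p * p ^ j) = (p : ℝ) ^ p ^ (d + 2 + j) := by
    exact_mod_cast card_levelFunctions h hd j
  rw [eq_div_of_mul_eq (pow_pos hp _).ne' h1]
  push_cast
  rw [← Real.rpow_natCast, ← Real.rpow_natCast, ← Real.rpow_sub hp, ← Real.rpow_mul hp.le]
  congr 1
  unfold dimension
  push_cast
  rw [pow_add (p : ℝ) (d + 2) j]
  field_simp

/-- From level `d + 2` on, passing to the next level raises both indices by factors whose logarithms
are in the ratio `dimension p d`. -/
theorem relIndex_topologicalClosure {d : ℕ} {c : ℕ → ZMod p} (h : IsCyclicPair ω ρ d c)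
    (hd : 1 ≤ d) : ∃ K : ℝ, 0 < K ∧ ∀ n, d + 2 ≤ n →
      ((levelStab p n).relIndex (spinalGroup ω ρ).topologicalClosure : ℝ) =
        K * (levelIndex p n : ℝ) ^ dimension p d := by
  have hpos : ∀ n, (0 : ℝ) < (levelIndex p n : ℝ) ^ dimension p d := fun n =>
    Real.rpow_pos_of_pos (by exact_mod_cast levelIndex_pos p n) _
  set S := (spinalGroup ω ρ).topologicalClosure with hS
  have hrel : (0 : ℝ) < (levelStab p (d + 2)).relIndex S := by
    exact_mod_cast Nat.pos_of_ne_zero Subgroup.FiniteIndex.index_ne_zero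
  refine ⟨(levelStab p (d + 2)).relIndex S / (levelIndex p (d + 2) : ℝ) ^ dimension p d,
    div_pos hrel (hpos _), fun n hn => ?_⟩
  obtain ⟨j, rfl⟩ := Nat.exists_eq_add_of_le hn
  clear hn
  induction j with
  | zero => rw [add_zero, div_mul_cancel₀ _ (hpos _).ne']
  | succ j ih =>
    rw [← add_assoc, relIndex_succ, levelIndex_succ (d + 2 + j), Nat.cast_mul, Nat.cast_mul, ih,
      levelFunctions_topologicalClosure, card_levelFunctions_eq_rpow h hd,
      Real.mul_rpow (Nat.cast_nonneg _) (Nat.cast_nonneg _), mul_assoc]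

end Counting

/-! ### Compactness and Hausdorff dimension -/

section Dimension

open MeasureTheory Filter Topology
open scoped ENNReal

variable {p : ℕ} [Fact p.Prime]

theorem dist_le_of_mem {n : ℕ} {x y : PAdicAut p} (h : x⁻¹ * y ∈ levelStab p n) :
    dist x y ≤ 1 / (levelIndex p n : ℝ) :=
  csInf_le (distSet_bddBelow x y) ⟨n, h, rfl⟩

theorem le_dist_of_notMem {n : ℕ} {x y : PAdicAut p} (h : x⁻¹ * y ∉ levelStab p (n + 1)) :
    1 / (levelIndex p n : ℝ) ≤ dist x y := by
  refine le_csInf (distSet_nonempty x y) ?_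
  rintro _ ⟨k, hk, rfl⟩
  refine le_of_not_gt fun hlt => h (levelStab_antitone p ?_ hk)
  exact one_div_levelIndex_lt.1 hlt

theorem one_div_levelIndex_pos (n : ℕ) : 0 < 1 / (levelIndex p n : ℝ) := by
  have := levelIndex_pos p n
  positivity

theorem tendsto_one_div_levelIndex :
    Tendsto (fun n => 1 / (levelIndex p n : ℝ)) atTop (𝓝 0) := by
  simp only [one_div]
  exact (tendsto_natCast_atTop_atTop.comp (levelIndex_strictMono p).tendsto_atTop).inv_tendsto_atTop

theorem isOpen_levelStab (n : ℕ) : IsOpen (levelStab p n : Set (PAdicAut p)) := by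
  refine Subgroup.isOpen_of_mem_nhds _ (g := 1) (Metric.mem_nhds_iff.2
    ⟨_, one_div_levelIndex_pos (p := p) n, fun x hx => ?_⟩)
  rw [Metric.mem_ball, dist_comm] at hx
  simpa using sInf_distSet_lt (f := 1) (g := x) hx

omit [Fact p.Prime] in
theorem mem_levelStab_of_actv_eq {n : ℕ} {g h : PAdicAut p}
    (H : ∀ u : List (ZMod p), u.length < n → actv g u = actv h u) :
    g⁻¹ * h ∈ levelStab p n := by
  have key : ∀ u : List (ZMod p), u.length ≤ n → g.act u = h.act u := by
    intro u hu
    induction u using List.reverseRecOn with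
    | nil => rw [act_nil, act_nil]
    | append_singleton u x ih =>
      have hu' : u.length < n := by simpa using hu
      rw [act_append_singleton, act_append_singleton, ih hu'.le, H u hu']
  intro u hu
  rw [act_mul, ← key u hu.le, ← act_mul, inv_mul_cancel, act_one]

theorem continuous_ofPortrait :
    Continuous (ofPortrait : (List (ZMod p) → ZMod p) → PAdicAut p) := by
  refine continuous_iff_continuousAt.2 fun φ => Metric.tendsto_nhds.2 fun ε hε => ?_
  obtain ⟨n, hn⟩ := ((tendsto_one_div_levelIndex (p := p)).eventually (gt_mem_nhds hε)).exists
  have hfin : {u : List (ZMod p) | u.length < n}.Finite := List.finite_length_lt _ _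
  filter_upwards [(eventually_all_finite hfin).2 fun u _ =>
    (continuous_apply u).continuousAt.eventually ((isOpen_discrete {φ u}).mem_nhds rfl)] with ψ hψ
  refine (dist_le_of_mem (mem_levelStab_of_actv_eq fun u hu => ?_)).trans_lt hn
  rw [actv_ofPortrait, actv_ofPortrait]
  exact hψ u hu

/-- The space of portraits, a product of finite discrete spaces, maps continuously onto `A(p)`. -/
instance : CompactSpace (PAdicAut p) := by
  have hsurj : Function.Surjective (ofPortrait : (List (ZMod p) → ZMod p) → PAdicAut p) :=
    fun g => ⟨_, ofPortrait_actv g⟩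
  exact hsurj.compactSpace continuous_ofPortrait

/-- Coverings by the cosets of the level stabilizers bound the dimension from above. -/
theorem hausdorffMeasure_ne_top [MeasurableSpace (PAdicAut p)] [BorelSpace (PAdicAut p)]
    {H : Subgroup (PAdicAut p)} {D K : ℝ} {n₀ : ℕ} (hD : 0 ≤ D)
    (hK : ∀ n, n₀ ≤ n → ((levelStab p n).relIndex H : ℝ) = K * (levelIndex p n : ℝ) ^ D) :
    μH[D] (H : Set (PAdicAut p)) ≠ ∞ := by
  have hfin : ∀ n, Finite (H ⧸ (levelStab p n).subgroupOf H) := fun n => inferInstance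
  have := fun n => Fintype.ofFinite (H ⧸ (levelStab p n).subgroupOf H)
  let t : ∀ n, H ⧸ (levelStab p n).subgroupOf H → Set (PAdicAut p) :=
    fun n q => {g | (q.out : PAdicAut p)⁻¹ * g ∈ levelStab p n}
  have hdiam : ∀ n q, Metric.ediam (t n q) ≤ ENNReal.ofReal (1 / (levelIndex p n : ℝ)) := by
    intro n q
    refine Metric.ediam_le fun x hx y hy => ?_
    rw [edist_dist]
    refine ENNReal.ofReal_le_ofReal (dist_le_of_mem ?_)
    have h := (levelStab p n).mul_mem ((levelStab p n).inv_mem hx) hy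
    simpa [mul_assoc] using h
  have hle := Measure.hausdorffMeasure_le_liminf_sum D (H : Set (PAdicAut p))
    (l := atTop) (fun n => ENNReal.ofReal (1 / (levelIndex p n : ℝ)))
    (by simpa using ENNReal.tendsto_ofReal (tendsto_one_div_levelIndex (p := p))) t
    (Eventually.of_forall hdiam) (Eventually.of_forall fun n g hg => by
      refine Set.mem_iUnion.2 ⟨QuotientGroup.mk ⟨g, hg⟩, ?_⟩
      have h := QuotientGroup.eq.1 (QuotientGroup.out_eq'
        (QuotientGroup.mk (s := (levelStab p n).subgroupOf H) ⟨g, hg⟩))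
      exact h)
  refine ne_top_of_le_ne_top (ENNReal.ofReal_ne_top (r := K)) (hle.trans ?_)
  refine (liminf_le_limsup).trans (limsup_le_of_le (h := ?_))
  filter_upwards [eventually_ge_atTop n₀] with n hn
  have hpos : (0 : ℝ) < levelIndex p n := by exact_mod_cast levelIndex_pos p n
  calc ∑ q, Metric.ediam (t n q) ^ D
      ≤ ∑ _q : H ⧸ (levelStab p n).subgroupOf H,
          ENNReal.ofReal (1 / (levelIndex p n : ℝ)) ^ D :=
        Finset.sum_le_sum fun q _ => ENNReal.rpow_le_rpow (hdiam n q) hD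
    _ = ENNReal.ofReal ((levelStab p n).relIndex H * (1 / (levelIndex p n : ℝ)) ^ D) := by
        rw [Finset.sum_const, nsmul_eq_mul, Finset.card_univ, ← Nat.card_eq_fintype_card,
          ENNReal.ofReal_rpow_of_nonneg (one_div_levelIndex_pos n).le hD,
          ENNReal.ofReal_mul (Nat.cast_nonneg _), ENNReal.ofReal_natCast]
        rfl
    _ = ENNReal.ofReal K := by
        rw [hK n hn, mul_assoc, ← Real.mul_rpow hpos.le (one_div_levelIndex_pos n).le,
          mul_one_div_cancel hpos.ne', Real.one_rpow, mul_one]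

/-- The mass distribution principle for the Haar measure bounds the dimension from below. -/
theorem hausdorffMeasure_univ_ne_zero {H : Subgroup (PAdicAut p)} [CompactSpace H]
    [MeasurableSpace H] [BorelSpace H] {D K : ℝ} {n₀ : ℕ} (hD : 0 < D) (hK0 : 0 < K)
    (hK : ∀ n, n₀ ≤ n → ((levelStab p n).relIndex H : ℝ) = K * (levelIndex p n : ℝ) ^ D) :
    μH[D] (Set.univ : Set H) ≠ 0 := by
  let μ : Measure H := Measure.haarMeasure ⊤
  have hμ : μ Set.univ = 1 :=
    Measure.haarMeasure_self (K₀ := (⊤ : TopologicalSpace.PositiveCompacts H))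
  have hcoset : ∀ n, n₀ ≤ n → ∀ s : Set H,
      (∀ x ∈ s, ∀ y ∈ s, (x : PAdicAut p)⁻¹ * y ∈ levelStab p n) →
      (ENNReal.ofReal K • μ) s ≤ ENNReal.ofReal (1 / (levelIndex p n : ℝ)) ^ D := by
    intro n hn s hs
    have hpos : (0 : ℝ) < levelIndex p n := by exact_mod_cast levelIndex_pos p n
    rcases s.eq_empty_or_nonempty with rfl | ⟨x, hx⟩
    · simp
    have hsub : s ⊆ (fun y => x⁻¹ * y) ⁻¹' ((levelStab p n).subgroupOf H : Set H) :=
      fun y hy => hs x hx y hy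
    have hmeas : MeasurableSet ((levelStab p n).subgroupOf H : Set H) :=
      ((isOpen_levelStab n).preimage continuous_subtype_val).measurableSet
    have hidx := Subgroup.index_mul_measure ((levelStab p n).subgroupOf H) hmeas μ
    have hle : μ s ≤ μ ((levelStab p n).subgroupOf H : Set H) :=
      (measure_mono hsub).trans (measure_preimage_mul μ x⁻¹ _).le
    rw [hμ] at hidx
    have hKn : ENNReal.ofReal K = ((levelStab p n).relIndex H : ℝ≥0∞) *
        ENNReal.ofReal ((1 / (levelIndex p n : ℝ)) ^ D) := by
      rw [← ENNReal.ofReal_natCast, ← ENNReal.ofReal_mul (Nat.cast_nonneg _), hK n hn, mul_assoc,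
        ← Real.mul_rpow hpos.le (one_div_levelIndex_pos n).le, mul_one_div_cancel hpos.ne',
        Real.one_rpow, mul_one]
    calc (ENNReal.ofReal K • μ) s
        ≤ ENNReal.ofReal K * μ ((levelStab p n).subgroupOf H : Set H) := by
          rw [Measure.smul_apply, smul_eq_mul]
          gcongr
      _ = ENNReal.ofReal ((1 / (levelIndex p n : ℝ)) ^ D) *
          (((levelStab p n).relIndex H : ℝ≥0∞) * μ ((levelStab p n).subgroupOf H : Set H)) := by
          rw [hKn]
          ring
      _ = ENNReal.ofReal (1 / (levelIndex p n : ℝ)) ^ D := by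
          rw [Subgroup.relIndex, hidx, mul_one,
            ENNReal.ofReal_rpow_of_nonneg (one_div_levelIndex_pos n).le hD.le]
  have hle : ENNReal.ofReal K • μ ≤ μH[D] := by
    refine Measure.le_hausdorffMeasure D _ (ENNReal.ofReal (1 / (levelIndex p (n₀ + 1) : ℝ)))
      (ENNReal.ofReal_pos.2 (one_div_levelIndex_pos _)) fun s hs => ?_
    have h0 : ∀ x ∈ s, ∀ y ∈ s, (x : PAdicAut p)⁻¹ * y ∈ levelStab p n₀ := by
      intro x hx y hy
      have h1 := (Metric.edist_le_ediam_of_mem hx hy).trans hs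
      rw [edist_dist, ENNReal.ofReal_le_ofReal_iff (one_div_levelIndex_pos _).le] at h1
      exact sInf_distSet_lt (h1.trans_lt (one_div_levelIndex_lt.2 (Nat.lt_succ_self n₀)))
    by_cases hall : ∀ n, n₀ ≤ n → ∀ x ∈ s, ∀ y ∈ s, (x : PAdicAut p)⁻¹ * y ∈ levelStab p n
    · have hz : (ENNReal.ofReal K • μ) s ≤ 0 := by
        have hlim : Tendsto (fun n => ENNReal.ofReal (1 / (levelIndex p n : ℝ)) ^ D) atTop
            (𝓝 0) := by
          have h1 := ENNReal.tendsto_ofReal (tendsto_one_div_levelIndex (p := p))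
          rw [ENNReal.ofReal_zero] at h1
          have h2 := (ENNReal.continuous_rpow_const (y := D)).tendsto 0
          rw [ENNReal.zero_rpow_of_pos hD] at h2
          exact h2.comp h1
        refine ge_of_tendsto hlim ?_
        filter_upwards [eventually_ge_atTop n₀] with n hn
        exact hcoset n hn s (hall n hn)
      exact hz.trans zero_le
    · -- The last level at which the elements of `s` agree determines the diameter of `s`.
      classical
      push Not at hall
      obtain ⟨hn, x, hx, y, hy, hxy⟩ := Nat.find_spec hall
      have hne : Nat.find hall ≠ n₀ := fun he => hxy (by rw [he]; exact h0 x hx y hy)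
      obtain ⟨n, hn1⟩ : ∃ n, Nat.find hall = n + 1 :=
        Nat.exists_eq_succ_of_ne_zero (by omega)
      have hmin := Nat.find_min hall (m := n) (by omega)
      push Not at hmin
      have hn2 : n₀ ≤ n := by omega
      refine (hcoset n hn2 s (hmin hn2)).trans (ENNReal.rpow_le_rpow ?_ hD.le)
      refine le_trans ?_ (Metric.edist_le_ediam_of_mem hx hy)
      rw [edist_dist]
      rw [hn1] at hxy
      exact ENNReal.ofReal_le_ofReal (le_dist_of_notMem hxy)
  have h1 := hle Set.univ
  rw [Measure.smul_apply, hμ, smul_eq_mul, mul_one] at h1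
  exact ((ENNReal.ofReal_pos.2 hK0).trans_le h1).ne'

theorem dimH_eq_of_relIndex {H : Subgroup (PAdicAut p)} (hH : IsClosed (H : Set (PAdicAut p)))
    {D K : ℝ} {n₀ : ℕ} (hD : 0 < D) (hK0 : 0 < K)
    (hK : ∀ n, n₀ ≤ n → ((levelStab p n).relIndex H : ℝ) = K * (levelIndex p n : ℝ) ^ D) :
    dimH (H : Set (PAdicAut p)) = ENNReal.ofReal D := by
  lift D to NNReal using hD.le
  rw [ENNReal.ofReal_coe_nnreal]
  refine le_antisymm ?_ ?_
  · borelize (PAdicAut p)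
    exact dimH_le_of_hausdorffMeasure_ne_top (hausdorffMeasure_ne_top hD.le hK)
  · have : CompactSpace H := isCompact_iff_compactSpace.1 hH.isCompact
    let : MeasurableSpace H := borel H
    have : BorelSpace H := ⟨rfl⟩
    have h1 := le_dimH_of_hausdorffMeasure_ne_zero
      (hausdorffMeasure_univ_ne_zero (H := H) hD hK0 hK)
    rwa [← (isometry_subtype_coe (s := (H : Set (PAdicAut p)))).dimH_image,
      Set.image_univ, Subtype.range_coe] at h1

end Dimension

/-! ### The companion matrix -/

section Companion

variable {p : ℕ} {f : (ZMod p)[X]}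

theorem omega_apply {i : Fin f.natDegree} (hi : (i : ℕ) + 1 = f.natDegree)
    (b : Fin f.natDegree → ZMod p) : omega f b = b i := by
  have h : ∀ j : Fin f.natDegree, (j : ℕ) + 1 = f.natDegree ↔ j = i := fun j => by
    rw [Fin.ext_iff]
    omega
  simp [omega, lastRow, Matrix.mulVec, dotProduct, h]

theorem rho_apply (b : Fin f.natDegree → ZMod p) (i : Fin f.natDegree) :
    rho f b i = ∑ j : Fin f.natDegree, (if (i : ℕ) = j + 1 then b j else 0) -
      f.coeff i * omega f b := by
  have hlt := i.2
  let l : Fin f.natDegree := ⟨f.natDegree - 1, by omega⟩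
  have hl : (l : ℕ) + 1 = f.natDegree := by simp only [l]; omega
  have h : ∀ j : Fin f.natDegree, companion f i j * b j =
      (if (i : ℕ) = j + 1 then b j else 0) + (if j = l then -(f.coeff i * b j) else 0) := by
    intro j
    have hj : (j : ℕ) + 1 = f.natDegree ↔ j = l := by
      rw [Fin.ext_iff]
      omega
    simp only [companion, Matrix.of_apply, hj]
    by_cases h1 : j = l
    · have h2 : (i : ℕ) ≠ j + 1 := by rw [h1, hl]; omega
      simp [h1, h1 ▸ h2]
    · simp [h1]
  change ∑ j, companion f i j * b j = _
  rw [Finset.sum_congr rfl fun j _ => h j, Finset.sum_add_distrib, Finset.sum_ite_eq',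
    if_pos (Finset.mem_univ l), omega_apply hl, sub_eq_add_neg]

theorem rho_apply_zero (b : Fin f.natDegree → ZMod p) (h : 0 < f.natDegree) :
    rho f b ⟨0, h⟩ = -(f.coeff 0 * omega f b) := by
  simp [rho_apply]

theorem rho_apply_succ (b : Fin f.natDegree → ZMod p) {i : ℕ} (h : i + 1 < f.natDegree) :
    rho f b ⟨i + 1, h⟩ = b ⟨i, by omega⟩ - f.coeff (i + 1) * omega f b := by
  rw [rho_apply]
  congr 1
  rw [Finset.sum_eq_single ⟨i, by omega⟩]
  · simp
  · intro j _ hj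
    refine if_neg fun h' => hj (Fin.ext ?_)
    simpa using h'.symm
  · simp

/-- While `ω` vanishes on the iterates of `b`, the companion matrix only shifts coordinates. -/
theorem coord_eq_zero {k : ℕ} {b : Fin f.natDegree → ZMod p}
    (hb : ∀ i < k, omega f ((rho f ^ i) b) = 0) (j : Fin f.natDegree)
    (hj : f.natDegree ≤ j + k) : b j = 0 := by
  induction k generalizing b j with
  | zero => exact absurd j.2 (by omega)
  | succ k ih =>
    have h0 : omega f b = 0 := hb 0 (by omega)
    by_cases hlast : (j : ℕ) + 1 = f.natDegree
    · rw [← omega_apply hlast b, h0]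
    · have h1 : (j : ℕ) + 1 < f.natDegree := by have := j.2; omega
      have h2 := ih (b := rho f b) (fun i hi => hb (i + 1) (by omega)) ⟨j + 1, h1⟩
        (by simp only; omega)
      rwa [rho_apply_succ, h0, mul_zero, sub_zero] at h2

variable [Fact p.Prime]

theorem exists_isCyclicPair {d : ℕ} (hd : f.natDegree = d + 1) (h0 : f.coeff 0 ≠ 0) :
    ∃ c, IsCyclicPair (omega f) (rho f) d c := by
  let Ω : (Fin f.natDegree → ZMod p) →ₗ[ZMod p] (Fin f.natDegree → ZMod p) :=
    LinearMap.pi fun i => omega f ∘ₗ rho f ^ (i : ℕ)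
  have hΩ : ∀ b i, Ω b i = omega f ((rho f ^ (i : ℕ)) b) := fun b i => rfl
  have hzero : ∀ b, (∀ i < f.natDegree, omega f ((rho f ^ i) b) = 0) → b = 0 := fun b hb =>
    funext fun j => coord_eq_zero hb j (by omega)
  have hΩinj : Function.Injective Ω := by
    refine (injective_iff_map_eq_zero Ω).2 fun b hb => hzero b fun i hi => ?_
    rw [← hΩ b ⟨i, hi⟩, hb]
    rfl
  have hρinj : Function.Injective (rho f) := by
    refine (injective_iff_map_eq_zero _).2 fun b hb => hzero b fun i _ => ?_
    cases i with
    | zero =>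
      have h1 := rho_apply_zero b (by omega : 0 < f.natDegree)
      rw [hb, Pi.zero_apply, zero_eq_neg, mul_eq_zero] at h1
      exact h1.resolve_left h0
    | succ i => rw [pow_succ, Module.End.mul_apply, hb, map_zero, map_zero]
  have hΩsurj : Function.Surjective Ω := LinearMap.injective_iff_surjective.1 hΩinj
  have hρsurj : Function.Surjective (rho f) := LinearMap.injective_iff_surjective.1 hρinj
  have hint : ∀ t : ℕ → ZMod p, ∃ b, ∀ i ≤ d, omega f ((rho f ^ i) b) = t i := by
    intro t
    obtain ⟨b, hb⟩ := hΩsurj fun i => t i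
    exact ⟨b, fun i hi => congrFun hb ⟨i, by omega⟩⟩
  let eΩ := LinearEquiv.ofBijective Ω ⟨hΩinj, hΩsurj⟩
  let eρ := LinearEquiv.ofBijective (rho f) ⟨hρinj, hρsurj⟩
  let χ : (Fin f.natDegree → ZMod p) →ₗ[ZMod p] ZMod p :=
    omega f ∘ₗ eρ.symm.toLinearMap ∘ₗ eΩ.symm.toLinearMap
  have hχ : ∀ b, χ (Ω (rho f b)) = omega f b := fun b => by
    have h1 : eΩ.symm (Ω (rho f b)) = rho f b := eΩ.symm_apply_apply _
    have h2 : eρ.symm (rho f b) = b := eρ.symm_apply_apply _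
    simp only [χ, LinearMap.comp_apply, LinearEquiv.coe_coe, h1, h2]
  let c : ℕ → ZMod p := fun i =>
    if h : i < f.natDegree then χ (fun j => if (⟨i, h⟩ : Fin f.natDegree) = j then 1 else 0) else 0
  have hrel : ∀ b, ∑ j ∈ Finset.range (d + 1), c j * omega f ((rho f ^ j) (rho f b)) =
      omega f b := by
    intro b
    rw [← hχ b, LinearMap.pi_apply_eq_sum_univ χ, ← hd, Finset.sum_range]
    refine Finset.sum_congr rfl fun j _ => ?_
    simp only [c, j.2, dif_pos, hΩ, smul_eq_mul]
    exact mul_comm _ _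
  refine ⟨c, hρsurj, hint, hrel, fun hcd => ?_⟩
  obtain ⟨b, hb⟩ := hint fun i => if i = 0 then 1 else 0
  have h1 := hrel b
  rw [Finset.sum_range_succ, hcd, zero_mul, add_zero, Finset.sum_eq_zero] at h1
  · have h2 := hb 0 (Nat.zero_le d)
    rw [pow_zero, Module.End.one_apply, ← h1] at h2
    simp at h2
  · intro j hj
    have h2 := hb (j + 1) (by have := Finset.mem_range.1 hj; omega)
    rw [pow_succ, Module.End.mul_apply] at h2
    rw [h2]
    simp

theorem isTopologicallyFG_polyGroup (f : (ZMod p)[X]) :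
    IsTopologicallyFG (polyGroup f).topologicalClosure :=
  ⟨_, (Set.finite_range _).union (Set.finite_range _), rfl⟩

theorem dimH_polyGroup (h0 : f.coeff 0 ≠ 0) {d : ℕ} (hd : 1 ≤ d) (hf : f.natDegree = d + 1) :
    dimH ((polyGroup f).topologicalClosure : Set (PAdicAut p)) =
      ENNReal.ofReal (dimension p d) := by
  obtain ⟨c, hc⟩ := exists_isCyclicPair hf h0
  obtain ⟨K, hK0, hK⟩ := relIndex_topologicalClosure hc hd
  exact dimH_eq_of_relIndex (Subgroup.isClosed_topologicalClosure _) (dimension_pos hd) hK0 hK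

open Filter Topology in
theorem tendsto_dimension : Tendsto (dimension p) atTop (𝓝 1) := by
  have hp : (1 : ℝ) < p := by exact_mod_cast (Fact.out : p.Prime).one_lt
  have h1 : Tendsto (fun d : ℕ => (codimension p : ℝ) / (p : ℝ) ^ (d + 2)) atTop (𝓝 0) :=
    ((tendsto_pow_atTop_atTop_of_one_lt hp).comp (tendsto_add_atTop_nat 2)).const_div_atTop _
  have h2 := h1.const_sub 1
  rw [sub_zero] at h2
  exact h2

theorem dimension_lt_one (d : ℕ) : dimension p d < 1 := by
  have hp : (0 : ℝ) < p := by exact_mod_cast (Fact.out : p.Prime).pos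
  have hc : (0 : ℝ) < codimension p := by
    unfold codimension
    split_ifs
    · norm_num
    · exact hp
  have := div_pos hc (pow_pos hp (d + 2))
  unfold dimension
  linarith

end Companion

end PAdicTree

open Filter Topology PAdicTree in
theorem theorem6p1 (p : ℕ) [Fact p.Prime] :
    -- the dimension formula, in both of its forms
    (∀ f : Polynomial (ZMod p), f.Monic → f.coeff 0 ≠ 0 → 2 ≤ f.natDegree →
      IsClosed ((polyGroup f).topologicalClosure : Set (PAdicAut p)) ∧
      IsTopologicallyFG (polyGroup f).topologicalClosure ∧
      dimH ((polyGroup f).topologicalClosure : Set (PAdicAut p)) =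
        ENNReal.ofReal
          (if p = 2 then 1 - 3 / 2 ^ (f.natDegree + 1) else 1 - 1 / (p : ℝ) ^ f.natDegree) ∧
      dimH ((polyGroup f).topologicalClosure : Set (PAdicAut p)) =
        ENNReal.ofReal (1 - (if p = 2 then 3 else (p : ℝ)) / (p : ℝ) ^ (f.natDegree + 1))) ∧
    -- the dimension tends to 1 along every sequence of groups with growing degree
    (∀ F : ℕ → Polynomial (ZMod p),
      (∀ m, 2 ≤ m → (F m).Monic ∧ (F m).coeff 0 ≠ 0 ∧ (F m).natDegree = m) →
      Tendsto (fun m => dimH ((polyGroup (F m)).topologicalClosure : Set (PAdicAut p)))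
        atTop (𝓝 1)) ∧
    -- topologically finitely generated closed subgroups of dimension arbitrarily close to 1
    (∀ ε : ℝ, 0 < ε → ∃ f : Polynomial (ZMod p),
      f.Monic ∧ f.coeff 0 ≠ 0 ∧ 2 ≤ f.natDegree ∧
      IsClosed ((polyGroup f).topologicalClosure : Set (PAdicAut p)) ∧
      IsTopologicallyFG (polyGroup f).topologicalClosure ∧
      ENNReal.ofReal (1 - ε) < dimH ((polyGroup f).topologicalClosure : Set (PAdicAut p)) ∧
      dimH ((polyGroup f).topologicalClosure : Set (PAdicAut p)) < 1) := by
  have hp : (0 : ℝ) < p := by exact_mod_cast (Fact.out : p.Prime).pos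
  refine ⟨fun f _ h0 h2 => ?_, fun F hF => ?_, fun ε hε => ?_⟩
  · obtain ⟨d, hd⟩ : ∃ d, f.natDegree = d + 1 := Nat.exists_eq_succ_of_ne_zero (by omega)
    have hdim := dimH_polyGroup h0 (by omega) hd
    refine ⟨Subgroup.isClosed_topologicalClosure _, isTopologicallyFG_polyGroup f, ?_, ?_⟩
    · rw [hdim, dimension, codimension, hd]
      congr 1
      split_ifs with h
      · subst h
        norm_num
      · rw [pow_succ (p : ℝ) (d + 1), div_mul_cancel_right₀ hp.ne', one_div]
    · rw [hdim, dimension, codimension, hd]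
      congr 2
      split_ifs <;> norm_num
  · have h1 : Tendsto (fun m => ENNReal.ofReal (dimension p (m - 1))) atTop (𝓝 1) := by
      have h := ENNReal.tendsto_ofReal
        ((tendsto_dimension (p := p)).comp (tendsto_sub_atTop_nat 1))
      rwa [ENNReal.ofReal_one] at h
    refine h1.congr' ?_
    filter_upwards [eventually_ge_atTop 2] with m hm
    obtain ⟨-, h0, hdeg⟩ := hF m hm
    exact (dimH_polyGroup h0 (by omega) (by omega)).symm
  · obtain ⟨d, hd1, hd⟩ := ((eventually_ge_atTop 1).and ((tendsto_dimension (p := p)).eventually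
      (lt_mem_nhds (sub_lt_self 1 hε)))).exists
    have hdeg : (Polynomial.X ^ (d + 1) + Polynomial.C 1 : Polynomial (ZMod p)).natDegree =
        d + 1 := Polynomial.natDegree_X_pow_add_C
    have h0 : (Polynomial.X ^ (d + 1) + Polynomial.C 1 : Polynomial (ZMod p)).coeff 0 ≠ 0 := by
      simp
    refine ⟨Polynomial.X ^ (d + 1) + Polynomial.C 1,
      Polynomial.monic_X_pow_add_C _ (Nat.succ_ne_zero d), h0, by omega,
      Subgroup.isClosed_topologicalClosure _, isTopologicallyFG_polyGroup _, ?_, ?_⟩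
    · rw [dimH_polyGroup h0 hd1 hdeg]
      exact (ENNReal.ofReal_lt_ofReal_iff (dimension_pos hd1)).2 hd
    · rw [dimH_polyGroup h0 hd1 hdeg, ← ENNReal.ofReal_one]
      exact (ENNReal.ofReal_lt_ofReal_iff one_pos).2 (dimension_lt_one d)
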